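/- \textbf{Theorem (Area formula via the Hopf fibration).} Identify $\mathbb{R}^3$ with the imaginary quaternions $\operatorname{Im}\mathbb{H}$, let $\mathbb{S}^2=\{p\in\operatorname{Im}\mathbb{H}: |p|=1\}$ and $\mathbb{S}^3=\{q\in\mathbb{H}:|q|=1\}$, and let $\pi\colon\mathbb{S}^3\to\mathbb{S}^2$, $\pi(q)=q\,\mathbf{i}\,\bar q$, be the Hopf map. For $p,p'\in\mathbb{S}^2$ with $p'\neq -p$ let $$\operatorname{Dihedral}(p,p')=\sqrt{\frac{1+\langle p,p'\rangle}{2}}+\frac{p\times p'}{\sqrt{2+2\langle p,p'\rangle}}\in\mathbb{S}^3,$$ the unit quaternion with positive real part that represents the minimal rotation taking $p$ to $p'$. Let $n\ge 1$ and let $\Gamma=(p_0,\dots,p_{n-1})$, $p_i\in\mathbb{S}^2$, $i\in\mathbb{Z}/n\mathbb{Z}$, be a spherical polygon with $p_{i+1}\neq -p_i$ for all $i$ (indices mod $n$; coinciding vertices and self-intersections are allowed). Let $C_\Gamma\colon\mathbb{R}/\mathbb{Z}\to\mathbb{S}^2$ be the closed path which on $[k/n,(k+1)/n]$ runs at constant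 speed along the shortest path on $\mathbb{S}^2$ from $p_k$ to $p_{k+1}$ (a constant path if $p_k=p_{k+1}$). An \emph{enclosed region} of $\Gamma$ is a Lipschitz map $S\colon\mathbb{D}^2\to\mathbb{S}^2$ on the closed unit disk with $S(e^{2\pi \mathrm{i} t})=C_\Gamma(t)$ for all $t$. Let $\sigma=x\,dy\wedge dz+y\,dz\wedge dx+z\,dx\wedge dy$ be the area form of $\mathbb{S}^2$. Then an enclosed region $S$ exists; for every enclosed region $S$ the pullback $S^*\sigma$ (defined almost everywhere) is integrable; and the class $$\operatorname{Area}(\Gamma):=\iint_{\mathbb{D}^2}S^*\sigma\ \in\ \mathbb{R}/4\pi\mathbb{Z}$$ does not depend on $S$. Let $q_i\in\mathbb{S}^3$ be arbitrary lifts of the vertices, $\pi(q_i)=p_i$. Then each quaternion $\bar q_{i+1}\operatorname{Dihedral}(p_i,p_{i+1})\,q_i$ is of the form $e^{\mathbf{i}\theta}$ with $\theta\in\mathbb{R}$; write $\arg$ for its argument $\theta\in(-\pi,\pi]$. Then $$\operatorname{Area}(\Gamma)\equiv 2\sum_{i=0}^{n-1}\arg\bigl(\bar q_{i+1}\operatorname{Dihedral}(p_i,p_{i+1})\,q_i\bigr)\pmod{4\pi}.$$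 -/

import Mathlib

open scoped Quaternion

noncomputable section

namespace SphericalPolygon

/-- The unit 2-sphere, as the set of imaginary quaternions of norm one. -/
def sphereTwo : Set ℍ[ℝ] := {p | p.re = 0 ∧ ‖p‖ = 1}

/-- The unit 3-sphere, as the set of quaternions of norm one. -/
def sphereThree : Set ℍ[ℝ] := Metric.sphere 0 1

/-- The quaternion unit `i`. -/
def quatI : ℍ[ℝ] := ⟨0, 1, 0, 0⟩

/-- The Hopf map `q ↦ q i q̄`. -/
def hopf (q : ℍ[ℝ]) : ℍ[ℝ] := q * quatI * star q

/-- The cross product of the imaginary parts, with values in the imaginary quaternions. -/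
def cross (u v : ℍ[ℝ]) : ℍ[ℝ] :=
  ⟨0, u.imJ * v.imK - u.imK * v.imJ, u.imK * v.imI - u.imI * v.imK,
    u.imI * v.imJ - u.imJ * v.imI⟩

/-- `Dihedral(p, p') = √((1 + ⟨p, p'⟩) / 2) + (p × p') / √(2 + 2 ⟨p, p'⟩)`. -/
def dihedral (p p' : ℍ[ℝ]) : ℍ[ℝ] :=
  ((Real.sqrt ((1 + inner ℝ p p') / 2) : ℝ) : ℍ[ℝ]) +
    (Real.sqrt (2 + 2 * inner ℝ p p'))⁻¹ • cross p p'

/-- The argument in `(-π, π]` of a quaternion of the form `e^{iθ}`. -/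
def quatArg (x : ℍ[ℝ]) : ℝ := Complex.arg ⟨x.re, x.imI⟩

/-- The constant speed parametrization on `[0, 1]` of the shortest path on the sphere from `p` to
`p'`, for `p' ≠ -p`: with `ω` the angle between `p` and `p'`, and `u` the unit tangent vector at
`p` pointing towards `p'`, it is `t ↦ cos (t ω) p + sin (t ω) u`. It is constant if `p = p'`. -/
def shortestArc (p p' : ℍ[ℝ]) (t : ℝ) : ℍ[ℝ] :=
  let ω : ℝ := Real.arccos (inner ℝ p p')
  let w : ℍ[ℝ] := p' - (inner ℝ p p' : ℝ) • p
  Real.cos (t * ω) • p + Real.sin (t * ω) • (‖w‖⁻¹ • w)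

/-- The closed path (of period `1`) obtained by concatenating the edges of the polygon: for
`k ≤ n t < k + 1` it runs along the edge from `p k` to `p (k + 1)`. -/
def closedPath {n : ℕ} (p : ZMod n → ℍ[ℝ]) (t : ℝ) : ℍ[ℝ] :=
  shortestArc (p (⌊n * t⌋ : ℤ)) (p ((⌊n * t⌋ : ℤ) + 1)) (Int.fract (n * t))

/-- The area form of the unit sphere, `σ = x dy ∧ dz + y dz ∧ dx + z dx ∧ dy`: at the point `p` and
on the tangent vectors `u`, `v` its value is `⟨p, u × v⟩`. -/
def areaForm (p u v : ℍ[ℝ]) : ℝ := inner ℝ p (cross u v)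

/-- `S` is an enclosed region of the polygon: a Lipschitz map from the closed unit disk to the
sphere which extends the closed path of the polygon, parametrized counterclockwise on the boundary
circle. The values of `S` outside the closed disk are irrelevant. -/
structure IsEnclosedRegion {n : ℕ} (p : ZMod n → ℍ[ℝ]) (S : ℂ → ℍ[ℝ]) : Prop where
  lipschitz : ∃ K : NNReal, LipschitzOnWith K S (Metric.closedBall 0 1)
  mapsTo : Set.MapsTo S (Metric.closedBall 0 1) sphereTwo
  boundary : ∀ t : ℝ, S (Complex.exp ((2 * Real.pi * t : ℝ) * Complex.I)) = closedPath p t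

/-- The density of the pullback `S^*σ` with respect to `dx ∧ dy` on the disk. A Lipschitz map is
differentiable almost everywhere, so this is defined almost everywhere. -/
def pullbackArea (S : ℂ → ℍ[ℝ]) (z : ℂ) : ℝ :=
  areaForm (S z) (fderiv ℝ S z 1) (fderiv ℝ S z Complex.I)

/-- The total signed area `∬ S^*σ` over the unit disk. -/
def regionArea (S : ℂ → ℍ[ℝ]) : ℝ := ∫ z in Metric.ball (0 : ℂ) 1, pullbackArea S z

open Classical in
/-- The signed area of the polygon in `ℝ / 4πℤ`: the class of the total signed area of an enclosed
region. (That there is one, and that the choice does not matter, is part of the theorem.) -/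
def signedArea {n : ℕ} (p : ZMod n → ℍ[ℝ]) : AddCircle (4 * Real.pi) :=
  if h : ∃ S, IsEnclosedRegion p S then ((regionArea h.choose : ℝ) : AddCircle (4 * Real.pi)) else 0

end SphericalPolygon

end

open scoped Quaternion

noncomputable section

namespace SphericalPolygon

open MeasureTheory Filter Topology Set

/-! The Hopf fibration is a circle bundle whose curvature is a multiple of the area form, so
spherical area is holonomy. The form B(u, v) = (ū v)ᵢ (`connectionForm`) is alternating and bilinear
on all of ℍ. It gives both the connection 1-form v ↦ B(q, v) on 𝕊³ and, up to a factor, its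
curvature: `areaForm_hopf` identifies σ, evaluated on the Hopf images of two tangent vectors, with
-4B.

A Lipschitz region S has a Lipschitz lift T to 𝕊³ (`exists_lipschitz_lift`). Since d(B(T, dT)) = 2
B(∂₁T, ∂₂T) dx ∧ dy, Stokes turns ∬ S^*σ into -2 times the integral of the connection form along the
boundary lift (`regionArea_eq_boundary_integral`). As T is only Lipschitz, Stokes is proved by a
discrete identity on small parallelograms, followed by dominated convergence and Rademacher's
theorem (`two_mul_integral_antisymm_fderiv`).

On the boundary, let Aₖ be the integral of the connection form over edge k. The horizontal lift of
that edge starting at qₖ ends at Dihedral(pₖ, pₖ₊₁) qₖ (`exists_horizontal_lift_shortestArc`), and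
the boundary lift turns by e^{iAₖ} relative to it (`star_mul_eq_mul_exp_of_horizontal`). With θₖ the
argument in the formula, the phase of the boundary lift against the chosen lifts changes by θₖ + Aₖ
on each edge. The loop closes, so Σ(θₖ + Aₖ) ∈ 2πℤ and the area is -2ΣAₖ ≡ 2Σθₖ mod 4π. The right
side does not involve S, which gives independence of the region.

Existence: finitely many edges miss the antipode of some v, and the straight cone from v over the
path, projected radially to the sphere, is a region. -/

@[simp] theorem re_quatI : quatI.re = 0 := rfl

@[simp] theorem imI_quatI : quatI.imI = 1 := rfl

@[simp] theorem imJ_quatI : quatI.imJ = 0 := rfl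

@[simp] theorem imK_quatI : quatI.imK = 0 := rfl

@[simp] theorem re_cross (u v : ℍ[ℝ]) : (cross u v).re = 0 := rfl

@[simp] theorem imI_cross (u v : ℍ[ℝ]) :
    (cross u v).imI = u.imJ * v.imK - u.imK * v.imJ := rfl

@[simp] theorem imJ_cross (u v : ℍ[ℝ]) :
    (cross u v).imJ = u.imK * v.imI - u.imI * v.imK := rfl

@[simp] theorem imK_cross (u v : ℍ[ℝ]) :
    (cross u v).imK = u.imI * v.imJ - u.imJ * v.imI := rfl

/-! ### Unit quaternions, the Hopf map and the dihedral quaternion -/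

theorem mul_star_of_norm_eq_one {q : ℍ[ℝ]} (hq : ‖q‖ = 1) : q * star q = 1 := by
  rw [Quaternion.self_mul_star, Quaternion.normSq_eq_norm_mul_self, hq]; simp

theorem star_mul_of_norm_eq_one {q : ℍ[ℝ]} (hq : ‖q‖ = 1) : star q * q = 1 := by
  rw [Quaternion.star_mul_self, Quaternion.normSq_eq_norm_mul_self, hq]; simp

theorem norm_quatI : ‖quatI‖ = 1 := by
  have h : ‖quatI‖ * ‖quatI‖ = 1 := by
    rw [← Quaternion.normSq_eq_norm_mul_self, Quaternion.normSq_def']; simp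
  nlinarith [norm_nonneg quatI]

theorem mul_quatI {q : ℍ[ℝ]} (hq : ‖q‖ = 1) : q * quatI = hopf q * q := by
  rw [hopf, mul_assoc _ _ q, star_mul_of_norm_eq_one hq, mul_one]

/-- Lying over p is used in the form q i = p q, which is linear in q and so easy to check for
products. -/
theorem hopf_eq_of_mul_quatI {q p : ℍ[ℝ]} (hq : ‖q‖ = 1) (h : q * quatI = p * q) :
    hopf q = p := by
  rw [hopf, h, mul_assoc, mul_star_of_norm_eq_one hq, mul_one]

theorem star_of_re_eq_zero {p : ℍ[ℝ]} (h : p.re = 0) : star p = -p := by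
  ext <;> simp [h]

theorem mul_self_of_mem_sphereTwo {p : ℍ[ℝ]} (hp : p ∈ sphereTwo) : p * p = -1 := by
  have := mul_star_of_norm_eq_one hp.2
  rw [star_of_re_eq_zero hp.1] at this
  rw [← this]; simp

theorem hopf_mem_sphereTwo {q : ℍ[ℝ]} (hq : ‖q‖ = 1) : hopf q ∈ sphereTwo := by
  constructor
  · simp [hopf]; ring
  · rw [hopf, norm_mul, norm_mul, norm_star, hq, norm_quatI]; norm_num

theorem one_sub_mul_mul {p p' : ℍ[ℝ]} (hp : p ∈ sphereTwo) : (1 - p' * p) * p = p + p' := by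
  rw [sub_mul, mul_assoc, mul_self_of_mem_sphereTwo hp]; simp

theorem mul_one_sub_mul {p p' : ℍ[ℝ]} (hp' : p' ∈ sphereTwo) : p' * (1 - p' * p) = p + p' := by
  rw [mul_sub, ← mul_assoc, mul_self_of_mem_sphereTwo hp']; simp [add_comm]

theorem norm_one_sub_mul {p p' : ℍ[ℝ]} (hp : p ∈ sphereTwo) : ‖1 - p' * p‖ = ‖p + p'‖ := by
  rw [← one_sub_mul_mul hp, norm_mul, hp.2, mul_one]

theorem norm_add_sq_of_mem_sphereTwo {p p' : ℍ[ℝ]} (hp : p ∈ sphereTwo) (hp' : p' ∈ sphereTwo) :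
    ‖p + p'‖ ^ 2 = 2 + 2 * inner ℝ p p' := by
  rw [norm_add_sq_real, hp.2, hp'.2]; ring

/-- For imaginary units, 1 - p'p = (1 + ⟨p, p'⟩) + p × p', and (1 - p'p)p = p + p' shows that its
norm is ‖p + p'‖. The square roots thus only normalize 1 - p'p, which is nonzero exactly when p' ≠
-p. -/
theorem dihedral_eq_smul {p p' : ℍ[ℝ]} (hp : p ∈ sphereTwo) (hp' : p' ∈ sphereTwo)
    (h : p' ≠ -p) : dihedral p p' = ‖p + p'‖⁻¹ • (1 - p' * p) := by
  have h0 : 0 < ‖p + p'‖ := norm_pos_iff.2 fun h' => h (eq_neg_of_add_eq_zero_right h')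
  have h2 := norm_add_sq_of_mem_sphereTwo hp hp'
  have h1 : Real.sqrt (2 + 2 * inner ℝ p p') = ‖p + p'‖ := by
    rw [← h2, Real.sqrt_sq h0.le]
  have h3 : Real.sqrt ((1 + inner ℝ p p') / 2) = ‖p + p'‖⁻¹ * (1 + inner ℝ p p') := by
    rw [Real.sqrt_eq_iff_mul_self_eq_of_pos]
    · field_simp
      rw [h2]; ring
    · have : 0 < ‖p + p'‖ ^ 2 := by positivity
      have : 0 < 1 + (inner ℝ p p' : ℝ) := by linarith
      positivity
  have h4 : 1 - p' * p = ((1 + inner ℝ p p' : ℝ) : ℍ[ℝ]) + cross p p' := by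
    ext <;> simp only [Quaternion.re_add, Quaternion.imI_add, Quaternion.imJ_add,
      Quaternion.imK_add, Quaternion.re_coe, Quaternion.imI_coe, Quaternion.imJ_coe,
      Quaternion.imK_coe, Quaternion.inner_def] <;> simp [hp.1, hp'.1] <;> ring
  rw [dihedral, h1, h3, h4, smul_add, Quaternion.coe_mul, Quaternion.coe_mul_eq_smul]

theorem norm_dihedral {p p' : ℍ[ℝ]} (hp : p ∈ sphereTwo) (hp' : p' ∈ sphereTwo)
    (h : p' ≠ -p) : ‖dihedral p p'‖ = 1 := by
  have h0 : ‖p + p'‖ ≠ 0 := norm_ne_zero_iff.2 fun h' => h (eq_neg_of_add_eq_zero_right h')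
  rw [dihedral_eq_smul hp hp' h, norm_smul, norm_one_sub_mul hp, norm_inv, norm_norm,
    inv_mul_cancel₀ h0]

theorem dihedral_mul {p p' : ℍ[ℝ]} (hp : p ∈ sphereTwo) (hp' : p' ∈ sphereTwo)
    (h : p' ≠ -p) : dihedral p p' * p = p' * dihedral p p' := by
  rw [dihedral_eq_smul hp hp' h, smul_mul_assoc, mul_smul_comm, one_sub_mul_mul hp,
    mul_one_sub_mul hp']

theorem dihedral_self {p : ℍ[ℝ]} (hp : p ∈ sphereTwo) : dihedral p p = 1 := by
  have h : p ≠ -p := by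
    intro h
    have h0 : p = 0 := by
      have h1 : (2 : ℝ) • p = 0 := by rw [two_smul]; nth_rewrite 2 [h]; exact add_neg_cancel p
      simpa using h1
    simpa [h0] using hp.2
  rw [dihedral_eq_smul hp hp h, mul_self_of_mem_sphereTwo hp, ← two_smul ℝ p, norm_smul, hp.2]
  ext <;> (simp; try norm_num)

theorem abs_imI_le_norm (x : ℍ[ℝ]) : |x.imI| ≤ ‖x‖ := by
  apply abs_le_of_sq_le_sq _ (norm_nonneg _)
  rw [sq ‖x‖, ← Quaternion.normSq_eq_norm_mul_self, Quaternion.normSq_def']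
  nlinarith [sq_nonneg x.re, sq_nonneg x.imJ, sq_nonneg x.imK]

/-! ### The connection form and its curvature -/

/-- At a unit quaternion `q`, the linear form `connectionForm q` is the standard connection form of
the Hopf fibration. -/
def connectionForm : ℍ[ℝ] →L[ℝ] ℍ[ℝ] →L[ℝ] ℝ :=
  LinearMap.mkContinuous₂
    (LinearMap.mk₂ ℝ (fun u v => (star u * v).imI) (by intros; simp; ring)
      (by intros; simp) (by intros; simp; ring) (by intros; simp)) 1 fun u v => by
    have h := abs_imI_le_norm (star u * v)
    rwa [norm_mul, norm_star, ← one_mul ‖u‖] at h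

theorem connectionForm_apply (u v : ℍ[ℝ]) : connectionForm u v = (star u * v).imI := rfl

theorem connectionForm_antisymm (u v : ℍ[ℝ]) : connectionForm u v = -connectionForm v u := by
  simp [connectionForm_apply]; ring

theorem areaForm_eq (p : ℍ[ℝ]) {u v : ℍ[ℝ]} (hp : p.re = 0) (hu : u.re = 0) (hv : v.re = 0) :
    areaForm p u v = -(p * u * v).re := by
  simp [areaForm, Quaternion.inner_def, hu, hv, hp]; ring

/-- The curvature identity of the Hopf fibration. -/
theorem areaForm_hopf {q a b : ℍ[ℝ]} (hq : ‖q‖ = 1) (ha : (star q * a).re = 0)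
    (hb : (star q * b).re = 0) :
    areaForm (hopf q) (a * quatI * star q + q * quatI * star a)
      (b * quatI * star q + q * quatI * star b) = -4 * connectionForm a b := by
  set α := star q * a with hα
  set β := star q * b with hβ
  have h1 := star_mul_of_norm_eq_one hq
  have h2 := mul_star_of_norm_eq_one hq
  have ea : a = q * α := by rw [hα, ← mul_assoc, h2, one_mul]
  have eb : b = q * β := by rw [hβ, ← mul_assoc, h2, one_mul]
  -- In the left trivialization a = qα with α imaginary, the differential of the Hopf map is q[α,
  -- i]q̄.
  have key : ∀ (a α : ℍ[ℝ]), a = q * α → α.re = 0 → a * quatI * star q + q * quatI * star a =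
      q * (α * quatI - quatI * α) * star q := by
    intro a α e h
    rw [e, star_mul, star_of_re_eq_zero h]
    noncomm_ring
  have re_conj : ∀ x : ℍ[ℝ], (q * x * star q).re = x.re := by
    intro x
    have h3 : (q * x * star q).re = (star q * q).re * x.re := by simp; ring
    rw [h3, h1]; simp
  have hc : connectionForm a b = (star α * β).imI := by
    rw [connectionForm_apply, ea, eb, star_mul, mul_assoc, ← mul_assoc (star q), h1, one_mul]
  rw [key a α ea ha, key b β eb hb, areaForm_eq _ (hopf_mem_sphereTwo hq).1, hopf, hc]
  -- Conjugation by q drops out of the real part, leaving -Re(i [α, i] [β, i]), a computation in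
  -- coordinates.
  · have : q * quatI * star q * (q * (α * quatI - quatI * α) * star q) *
        (q * (β * quatI - quatI * β) * star q) =
        q * (quatI * ((star q * q) * (α * quatI - quatI * α)) * ((star q * q) *
          (β * quatI - quatI * β))) * star q := by noncomm_ring
    rw [this, re_conj, h1]
    simp [ha, hb]; ring
  · rw [re_conj]; simp
  · rw [re_conj]; simp

/-- Quaternions that commute with `i` are complex numbers. -/
theorem imJ_imK_eq_zero_of_commute {x : ℍ[ℝ]} (h : x * quatI = quatI * x) :
    x.imJ = 0 ∧ x.imK = 0 := by
  have h1 := congrArg QuaternionAlgebra.imJ h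
  have h2 := congrArg QuaternionAlgebra.imK h
  simp at h1 h2
  constructor <;> linarith

theorem eq_coeComplex_of_commute {x : ℍ[ℝ]} (h : x * quatI = quatI * x) :
    x = ((⟨x.re, x.imI⟩ : ℂ) : ℍ[ℝ]) := by
  obtain ⟨h1, h2⟩ := imJ_imK_eq_zero_of_commute h
  ext <;> simp [h1, h2]

theorem norm_coeComplex (z : ℂ) : ‖(z : ℍ[ℝ])‖ = ‖z‖ := by
  have h : ‖(z : ℍ[ℝ])‖ * ‖(z : ℍ[ℝ])‖ = ‖z‖ * ‖z‖ := by
    rw [← Quaternion.normSq_eq_norm_mul_self, Complex.norm_mul_self_eq_normSq,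
      Quaternion.normSq_def', Complex.normSq_apply]
    simp; ring
  nlinarith [norm_nonneg (z : ℍ[ℝ]), norm_nonneg z]

theorem eq_exp_quatArg {x : ℍ[ℝ]} (hx : ‖x‖ = 1) (h : x * quatI = quatI * x) :
    x = ((Complex.exp ((quatArg x : ℝ) * Complex.I) : ℂ) : ℍ[ℝ]) := by
  have h1 := eq_coeComplex_of_commute h
  have h2 : ‖(⟨x.re, x.imI⟩ : ℂ)‖ = 1 := by rw [← norm_coeComplex, ← h1, hx]
  have h3 := Complex.norm_mul_exp_arg_mul_I (⟨x.re, x.imI⟩ : ℂ)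
  rw [h2, Complex.ofReal_one, one_mul] at h3
  rw [quatArg, h3, ← h1]

theorem star_mul_commute {q q' : ℍ[ℝ]} (hq : ‖q‖ = 1) (hq' : ‖q'‖ = 1) (h : hopf q = hopf q') :
    star q * q' * quatI = quatI * (star q * q') := by
  have h1 : star q * hopf q = quatI * star q := by
    rw [hopf, ← mul_assoc, ← mul_assoc, star_mul_of_norm_eq_one hq, one_mul]
  rw [mul_assoc, mul_quatI hq', ← h, ← mul_assoc, h1, mul_assoc]

theorem hopf_dihedral_mul {p p' q : ℍ[ℝ]} (hp : p ∈ sphereTwo) (hp' : p' ∈ sphereTwo)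
    (h : p' ≠ -p) (hq : ‖q‖ = 1) (hpq : hopf q = p) : hopf (dihedral p p' * q) = p' := by
  apply hopf_eq_of_mul_quatI
  · rw [norm_mul, hq, norm_dihedral hp hp' h, one_mul]
  · rw [mul_assoc, mul_quatI hq, hpq, ← mul_assoc, dihedral_mul hp hp' h, mul_assoc]

theorem norm_of_mem_sphereThree {q : ℍ[ℝ]} (h : q ∈ sphereThree) : ‖q‖ = 1 := by
  simpa [sphereThree] using h

/-! ### Stokes' theorem for Lipschitz maps and constant-coefficient forms -/

section Stokes

variable {E : Type*} [NormedAddCommGroup E] [NormedSpace ℝ E]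

/-- Discrete Stokes: two triangles of the quadrilateral on the left, the circuit x → y → w → z → x
on the right. -/
theorem antisymm_quadrilateral (B : E →L[ℝ] E →L[ℝ] ℝ) (hB : ∀ u v, B u v = -B v u)
    (x y z w : E) :
    B (y - x) (z - x) + B (z - w) (y - w) = B x y + B y w - B z w - B x z := by
  have h0 : ∀ u, B u u = 0 := fun u => by linarith [hB u u]
  simp only [map_sub, sub_apply, h0]
  rw [hB y x, hB z y, hB w y]
  ring

theorem intervalIntegral_sub_comp_add_of_periodic {f : ℝ → ℝ} (hf : Continuous f) {T : ℝ}
    (hper : Function.Periodic f T) (a h : ℝ) : ∫ t in a..a + T, (f t - f (t + h)) = 0 := by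
  rw [intervalIntegral.integral_sub (hf.intervalIntegrable _ _)
    (Continuous.intervalIntegrable (by fun_prop) _ _), intervalIntegral.integral_comp_add_right,
    show a + T + h = a + h + T by ring, hper.intervalIntegral_add_eq (a + h) a, sub_self]

/-- The two integrals overlap except on strips of width h at the ends, where f is constant. -/
theorem intervalIntegral_comp_add_sub {f : ℝ → ℝ} (hf : Continuous f) {c d h x y : ℝ}
    (hc : ∀ r ∈ uIcc c (c + h), f r = x) (hd : ∀ r ∈ uIcc d (d + h), f r = y) :
    ∫ r in c..d, (f (r + h) - f r) = h * (y - x) := by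
  rw [intervalIntegral.integral_sub (Continuous.intervalIntegrable (by fun_prop) _ _)
    (hf.intervalIntegrable _ _), intervalIntegral.integral_comp_add_right]
  have h1 := intervalIntegral.integral_add_adjacent_intervals (hf.intervalIntegrable (μ := volume) c d)
    (hf.intervalIntegrable d (d + h))
  have h2 := intervalIntegral.integral_add_adjacent_intervals
    (hf.intervalIntegrable (μ := volume) c (c + h)) (hf.intervalIntegrable (c + h) (d + h))
  rw [intervalIntegral.integral_congr (g := fun _ => y) hd, intervalIntegral.integral_const] at h1
  rw [intervalIntegral.integral_congr (g := fun _ => x) hc, intervalIntegral.integral_const] at h2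
  simp only [smul_eq_mul, add_sub_cancel_left] at h1 h2
  linarith

variable (B : E →L[ℝ] E →L[ℝ] ℝ) {F : ℝ × ℝ → E} {a T : ℝ}

/-- Summed over all parallelograms, the radial edges cancel by periodicity and the circumferential
ones telescope in r. The range starts at -1 so that, for h ≤ 1, the lower strip [-1, -1 + h] lies
where F is constant and B(u, u) = 0 applies; the upper strip [1, 1 + h] sees only the boundary
values. -/
theorem integral_quadrilateral (hB : ∀ u v, B u v = -B v u) (hF : Continuous F) (hT : 0 ≤ T)
    (hper : ∀ r t, F (r, t + T) = F (r, t)) (h1 : ∀ r t, 1 ≤ r → F (r, t) = F (1, t))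
    (h0 : ∀ r t, r ≤ 0 → F (r, t) = F (0, 0)) {h : ℝ} (hh : 0 ≤ h) (hh1 : h ≤ 1) :
    ∫ x in Ioc (-1 : ℝ) 1 ×ˢ Ioc a (a + T),
      (B (F (x + h • (1, 0)) - F x) (F (x + h • (0, 1)) - F x) +
        B (F (x + h • (0, 1)) - F (x + h • (1, 1))) (F (x + h • (1, 0)) - F (x + h • (1, 1)))) =
      h * ∫ t in a..a + T, B (F (1, t)) (F (1, t + h)) := by
  have hB0 : ∀ u, B u u = 0 := fun u => by linarith [hB u u]
  simp only [antisymm_quadrilateral B hB]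
  rw [Measure.volume_eq_prod, setIntegral_prod]
  · have inner : ∀ r : ℝ, ∫ t in Ioc a (a + T), (B (F (r, t)) (F ((r, t) + h • (1, 0))) +
        B (F ((r, t) + h • (1, 0))) (F ((r, t) + h • (1, 1))) -
        B (F ((r, t) + h • (0, 1))) (F ((r, t) + h • (1, 1))) -
        B (F (r, t)) (F ((r, t) + h • (0, 1)))) =
        (∫ t in a..a + T, B (F (r + h, t)) (F (r + h, t + h))) -
          ∫ t in a..a + T, B (F (r, t)) (F (r, t + h)) := by
      intro r
      have hz := intervalIntegral_sub_comp_add_of_periodic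
        (f := fun t => B (F (r, t)) (F (r + h, t))) (by fun_prop) (T := T)
        (fun t => by simp only [hper]) a h
      rw [← intervalIntegral.integral_of_le (by linarith), ← intervalIntegral.integral_sub
        (Continuous.intervalIntegrable (by fun_prop) _ _)
        (Continuous.intervalIntegrable (by fun_prop) _ _), ← sub_eq_zero, ← intervalIntegral.integral_sub
        (Continuous.intervalIntegrable (by fun_prop) _ _)
        (Continuous.intervalIntegrable (by fun_prop) _ _)]
      refine (intervalIntegral.integral_congr fun t _ => ?_).trans hz
      simp only [Prod.smul_mk, smul_eq_mul, mul_one, mul_zero, Prod.mk_add_mk, add_zero]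
      ring
    simp only [inner]
    rw [← intervalIntegral.integral_of_le (by norm_num)]
    rw [intervalIntegral_comp_add_sub (f := fun r => ∫ t in a..a + T, B (F (r, t)) (F (r, t + h)))
      (x := 0) (y := ∫ t in a..a + T, B (F (1, t)) (F (1, t + h))), sub_zero]
    · exact intervalIntegral.continuous_parametric_intervalIntegral_of_continuous' (by fun_prop) _ _
    · intro r hr
      rw [uIcc_of_le (by linarith)] at hr
      simp only [h0 r _ (by linarith [hr.2]), hB0, intervalIntegral.integral_zero]
    · intro r hr
      rw [uIcc_of_le (by linarith)] at hr
      simp only [h1 r _ hr.1]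
  · exact (Continuous.integrableOn_Icc (by fun_prop)).mono_set
      ((Set.prod_mono Ioc_subset_Icc_self Ioc_subset_Icc_self).trans_eq (Icc_prod_Icc _ _ _ _))

/-- The factor 2 arises because each of the two triangles contributes B(∂₁F, ∂₂F); the signs in the
second triangle cancel. -/
theorem tendsto_quadrilateral {x : ℝ × ℝ} (hF : DifferentiableAt ℝ F x) :
    Tendsto (fun h : ℝ => (h ^ 2)⁻¹ * (B (F (x + h • (1, 0)) - F x) (F (x + h • (0, 1)) - F x) +
        B (F (x + h • (0, 1)) - F (x + h • (1, 1))) (F (x + h • (1, 0)) - F (x + h • (1, 1)))))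
      (𝓝[>] 0) (𝓝 (2 * B (fderiv ℝ F x (1, 0)) (fderiv ℝ F x (0, 1)))) := by
  have hlim : ∀ v, Tendsto (fun h : ℝ => h⁻¹ • (F (x + h • v) - F x)) (𝓝[>] 0)
      (𝓝 (fderiv ℝ F x v)) := fun v =>
    (hF.hasFDerivAt.hasLineDerivAt v).tendsto_slope_zero_right
  have cB : Continuous fun p : E × E => B p.1 p.2 := by fun_prop
  have l1 := (cB.tendsto _).comp ((hlim (1, 0)).prodMk_nhds (hlim (0, 1)))
  have l2 := (cB.tendsto _).comp (((hlim (0, 1)).sub (hlim (1, 1))).prodMk_nhds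
    ((hlim (1, 0)).sub (hlim (1, 1))))
  have l3 := l1.add l2
  have e1 : fderiv ℝ F x (0, 1) - fderiv ℝ F x (1, 1) = -fderiv ℝ F x (1, 0) := by
    rw [← map_sub, ← map_neg]; simp
  have e2 : fderiv ℝ F x (1, 0) - fderiv ℝ F x (1, 1) = -fderiv ℝ F x (0, 1) := by
    rw [← map_sub, ← map_neg]; simp
  simp only [e1, e2, map_neg, neg_apply, neg_neg, ← two_mul] at l3
  refine l3.congr fun h => ?_
  simp only [Function.comp_apply, ← smul_sub, sub_sub_sub_cancel_right, map_smul,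
    smul_apply, smul_eq_mul]
  ring

/-- **Stokes' theorem** for the pullback under a Lipschitz map of a form with constant
coefficients, on a cylinder whose bottom is mapped to a point. -/
theorem two_mul_integral_antisymm_fderiv [FiniteDimensional ℝ E] (hB : ∀ u v, B u v = -B v u)
    {K : NNReal} (hF : LipschitzWith K F) (hT : 0 ≤ T)
    (hper : ∀ r t, F (r, t + T) = F (r, t)) (h1 : ∀ r t, 1 ≤ r → F (r, t) = F (1, t))
    (h0 : ∀ r t, r ≤ 0 → F (r, t) = F (0, 0)) :
    2 * ∫ x in Ioc (-1 : ℝ) 1 ×ˢ Ioc a (a + T), B (fderiv ℝ F x (1, 0)) (fderiv ℝ F x (0, 1)) =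
      ∫ t in a..a + T, B (F (1, t)) (deriv (fun s => F (1, s)) t) := by
  have hc := hF.continuous
  have hB0 : ∀ u, B u u = 0 := fun u => by linarith [hB u u]
  have hBle : ∀ u v : E, ∀ c d : ℝ, 0 ≤ c → ‖u‖ ≤ c → ‖v‖ ≤ d → ‖B u v‖ ≤ ‖B‖ * c * d := by
    intro u v c d hc hu hv
    refine (B.le_opNorm₂ u v).trans ?_
    gcongr
  have hmem : Ioc (0 : ℝ) 1 ∈ 𝓝[>] (0 : ℝ) := Ioc_mem_nhdsGT one_pos
  have hdist : ∀ x y : ℝ × ℝ, ∀ h : ℝ, ‖x - y‖ ≤ h → ‖F x - F y‖ ≤ K * h := fun x y h hxy =>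
    (hF.norm_sub_le x y).trans (by gcongr)
  have lhs : Tendsto (fun h : ℝ => ∫ x in Ioc (-1 : ℝ) 1 ×ˢ Ioc a (a + T),
      (h ^ 2)⁻¹ * (B (F (x + h • (1, 0)) - F x) (F (x + h • (0, 1)) - F x) +
        B (F (x + h • (0, 1)) - F (x + h • (1, 1))) (F (x + h • (1, 0)) - F (x + h • (1, 1)))))
      (𝓝[>] 0) (𝓝 (∫ x in Ioc (-1 : ℝ) 1 ×ˢ Ioc a (a + T),
        2 * B (fderiv ℝ F x (1, 0)) (fderiv ℝ F x (0, 1)))) := by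
    -- Increments of F are at most K h, so each triangle is at most ‖B‖K²h², uniformly compensated
    -- by h⁻². Pointwise convergence holds almost everywhere by Rademacher.
    apply tendsto_integral_filter_of_dominated_convergence (fun _ => 2 * (‖B‖ * K * K))
    · exact Eventually.of_forall fun h =>
        Continuous.aestronglyMeasurable (by fun_prop)
    · filter_upwards [hmem] with h hh
      refine Eventually.of_forall fun x => ?_
      have hh0 : 0 < h := hh.1
      have b1 := hBle (F (x + h • (1, 0)) - F x) (F (x + h • (0, 1)) - F x) (K * h) (K * h)
        (by positivity)
        (hdist _ _ _ (by simp [abs_of_pos hh0, hh0.le])) (hdist _ _ _ (by simp [abs_of_pos hh0, hh0.le]))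
      have b2 := hBle (F (x + h • (0, 1)) - F (x + h • (1, 1)))
        (F (x + h • (1, 0)) - F (x + h • (1, 1))) (K * h) (K * h) (by positivity)
        (hdist _ _ _ (by simp [abs_of_pos hh0, hh0.le])) (hdist _ _ _ (by simp [abs_of_pos hh0, hh0.le]))
      rw [norm_mul, norm_inv, norm_pow, Real.norm_of_nonneg hh0.le]
      refine (mul_le_mul_of_nonneg_left ((norm_add_le _ _).trans (add_le_add b1 b2))
        (by positivity)).trans_eq ?_
      field_simp
      ring
    · have : IsFiniteMeasure ((volume : Measure (ℝ × ℝ)).restrict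
          (Ioc (-1 : ℝ) 1 ×ˢ Ioc a (a + T))) := by
        refine isFiniteMeasure_restrict.2 ?_
        rw [Measure.volume_eq_prod, Measure.prod_prod]
        simp [ENNReal.mul_eq_top]
      exact integrable_const _
    · refine ae_restrict_of_ae ?_
      filter_upwards [hF.ae_differentiableAt] with x hx
      exact tendsto_quadrilateral B hx
  have rhs : Tendsto (fun h : ℝ => ∫ t in a..a + T,
      B (F (1, t)) (h⁻¹ • (F (1, t + h) - F (1, t)))) (𝓝[>] 0)
      (𝓝 (∫ t in a..a + T, B (F (1, t)) (deriv (fun s => F (1, s)) t))) := by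
    have hL : LipschitzWith K fun s => F (1, s) := by
      simpa [Function.comp_def] using hF.comp (LipschitzWith.prodMk_left (1 : ℝ))
    apply intervalIntegral.tendsto_integral_filter_of_dominated_convergence
      (fun t => ‖B‖ * ‖F (1, t)‖ * K)
    · exact Eventually.of_forall fun h =>
        Continuous.aestronglyMeasurable (by fun_prop)
    · filter_upwards [hmem] with h hh
      refine Eventually.of_forall fun t _ => ?_
      have hh0 : 0 < h := hh.1
      refine hBle _ _ _ _ (norm_nonneg _) le_rfl ?_
      rw [norm_smul, norm_inv, Real.norm_of_nonneg hh0.le, inv_mul_le_iff₀ hh0, mul_comm]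
      exact hdist _ _ _ (by simp [abs_of_pos hh0, hh0.le])
    · exact Continuous.intervalIntegrable (by fun_prop) _ _
    · filter_upwards [hL.ae_differentiableAt_real] with t ht _
      have cB : Continuous fun v : E => B (F (1, t)) v := by fun_prop
      exact (cB.tendsto _).comp ht.hasDerivAt.tendsto_slope_zero_right
  rw [← integral_const_mul]
  refine tendsto_nhds_unique lhs (rhs.congr' ?_)
  -- The two families agree for every h in (0, 1]; subtracting F (1, t) in the second slot is free
  -- because B(u, u) = 0.
  filter_upwards [hmem] with h hh
  have hh0 : 0 < h := hh.1
  rw [integral_const_mul, integral_quadrilateral B hB hc hT hper h1 h0 hh0.le hh.2, ← mul_assoc,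
    ← intervalIntegral.integral_const_mul]
  refine intervalIntegral.integral_congr fun t _ => ?_
  simp only [map_smul, map_sub, hB0, sub_zero, smul_eq_mul]
  field_simp

end Stokes

/-! ### Lipschitz lifts through the Hopf map -/

section Lift

/-- Weighting by ‖x‖ means that only one vector needs a lower bound on its norm when this is
applied. Zero vectors are covered because 0⁻¹ = 0. -/
theorem norm_mul_norm_normalize_sub_le {E : Type*} [NormedAddCommGroup E] [NormedSpace ℝ E]
    (x y : E) : ‖x‖ * ‖‖x‖⁻¹ • x - ‖y‖⁻¹ • y‖ ≤ 2 * ‖x - y‖ := by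
  have h : ∀ z : E, ‖z‖ • ‖z‖⁻¹ • z = z := by
    intro z
    rcases eq_or_ne z 0 with rfl | hz
    · simp
    · rw [smul_smul, mul_inv_cancel₀ (norm_ne_zero_iff.2 hz), one_smul]
  have h1 : ‖x‖ • (‖x‖⁻¹ • x - ‖y‖⁻¹ • y) = (x - y) + (‖y‖ - ‖x‖) • ‖y‖⁻¹ • y := by
    rw [smul_sub, sub_smul, h, h]; abel
  have h2 : ‖‖y‖⁻¹ • y‖ ≤ 1 := by
    rw [norm_smul, norm_inv, norm_norm]; exact inv_mul_le_one
  calc ‖x‖ * ‖‖x‖⁻¹ • x - ‖y‖⁻¹ • y‖ = ‖‖x‖ • (‖x‖⁻¹ • x - ‖y‖⁻¹ • y)‖ := by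
        rw [norm_smul, norm_norm]
    _ ≤ ‖x - y‖ + ‖‖y‖ - ‖x‖‖ * ‖‖y‖⁻¹ • y‖ := by
        rw [h1, ← norm_smul]; exact norm_add_le _ _
    _ ≤ ‖x - y‖ + ‖x - y‖ * 1 := by
        gcongr
        rw [norm_sub_rev x y]; exact abs_norm_sub_norm_le y x
    _ = 2 * ‖x - y‖ := by ring

theorem norm_mul_sub_mul_le (a b c d : ℍ[ℝ]) :
    ‖a * b - c * d‖ ≤ ‖a - c‖ * ‖b‖ + ‖c‖ * ‖b - d‖ := by
  rw [← norm_mul, ← norm_mul, show a * b - c * d = (a - c) * b + c * (b - d) by noncomm_ring]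
  exact norm_add_le _ _

theorem ne_neg_of_norm_sub_le_one {p p' : ℍ[ℝ]} (hp : p ∈ sphereTwo) (h : ‖p - p'‖ ≤ 1) :
    p' ≠ -p := by
  rintro rfl
  rw [sub_neg_eq_add, ← two_smul ℝ, norm_smul, hp.2] at h
  norm_num at h

/-- At distance at most 1 one has ‖1 - p'p‖ = ‖p + p'‖ ≥ 2 - 1, so the normalization is 2-Lipschitz
there. -/
theorem norm_dihedral_sub_le {p p' r r' : ℍ[ℝ]} (hp : p ∈ sphereTwo) (hp' : p' ∈ sphereTwo)
    (hr : r ∈ sphereTwo) (hr' : r' ∈ sphereTwo) (h : ‖p - p'‖ ≤ 1) (h' : ‖r - r'‖ ≤ 1) :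
    ‖dihedral p p' - dihedral r r'‖ ≤ 2 * (‖p - r‖ + ‖p' - r'‖) := by
  rw [dihedral_eq_smul hp hp' (ne_neg_of_norm_sub_le_one hp h),
    dihedral_eq_smul hr hr' (ne_neg_of_norm_sub_le_one hr h'), ← norm_one_sub_mul hp,
    ← norm_one_sub_mul hr]
  have h1 : 1 ≤ ‖1 - p' * p‖ := by
    rw [norm_one_sub_mul hp]
    have h2 : ‖(2 : ℝ) • p‖ ≤ ‖p + p'‖ + ‖p - p'‖ := by
      rw [show (2 : ℝ) • p = (p + p') + (p - p') by rw [two_smul]; abel]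
      exact norm_add_le _ _
    rw [norm_smul, hp.2] at h2
    norm_num at h2
    linarith
  have h3 := norm_mul_norm_normalize_sub_le (1 - p' * p) (1 - r' * r)
  have h4 := norm_mul_sub_mul_le r' r p' p
  rw [hr.2, hp'.2, norm_sub_rev r', norm_sub_rev r] at h4
  rw [sub_sub_sub_cancel_left] at h3
  nlinarith [norm_nonneg (‖1 - p' * p‖⁻¹ • (1 - p' * p) - ‖1 - r' * r‖⁻¹ • (1 - r' * r))]

theorem quatI_mem_sphereTwo : quatI ∈ sphereTwo := ⟨rfl, norm_quatI⟩

theorem exists_hopf_eq {p : ℍ[ℝ]} (hp : p ∈ sphereTwo) : ∃ q : ℍ[ℝ], ‖q‖ = 1 ∧ hopf q = p := by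
  have h1 : hopf 1 = quatI := by simp [hopf]
  rcases eq_or_ne p (-quatI) with rfl | h
  -- The dihedral quaternion from i is undefined at -i; there the unit j works, since j i = -i j.
  · obtain ⟨j, h0, h1, h2, h3⟩ : ∃ j : ℍ[ℝ], j.re = 0 ∧ j.imI = 0 ∧ j.imJ = 1 ∧ j.imK = 0 :=
      ⟨⟨0, 0, 1, 0⟩, rfl, rfl, rfl, rfl⟩
    have hn : ‖j‖ = 1 := by
      have h : ‖j‖ * ‖j‖ = 1 := by
        rw [← Quaternion.normSq_eq_norm_mul_self, Quaternion.normSq_def']; simp [h0, h1, h2, h3]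
      nlinarith [norm_nonneg j]
    refine ⟨j, hn, hopf_eq_of_mul_quatI hn ?_⟩
    ext <;> simp [h0, h1, h2, h3]
  · refine ⟨dihedral quatI p * 1, ?_, hopf_dihedral_mul quatI_mem_sphereTwo hp h norm_one h1⟩
    rw [mul_one, norm_dihedral quatI_mem_sphereTwo hp h]

/-- A Lipschitz map from the disk to the 2-sphere has a Lipschitz lift to the 3-sphere. -/
theorem exists_lipschitz_lift {S : ℂ → ℍ[ℝ]} {K : NNReal}
    (hS : LipschitzOnWith K S (Metric.closedBall 0 1))
    (hmaps : MapsTo S (Metric.closedBall 0 1) sphereTwo) :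
    ∃ (T : ℂ → ℍ[ℝ]) (L : NNReal), LipschitzOnWith L T (Metric.closedBall 0 1) ∧
      ∀ z ∈ Metric.closedBall (0 : ℂ) 1, ‖T z‖ = 1 ∧ hopf (T z) = S z := by
  -- With N > K, the values of S at (k/N)z and ((k+1)/N)z differ by at most 1, within reach of the
  -- dihedral estimate.
  obtain ⟨N, hN⟩ := exists_nat_gt (K : ℝ)
  have hN0 : (0 : ℝ) < N := K.2.trans_lt hN
  have hmem : ∀ k : ℕ, k ≤ N → ∀ z ∈ Metric.closedBall (0 : ℂ) 1,
      (k / N : ℝ) • z ∈ Metric.closedBall (0 : ℂ) 1 := by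
    intro k hk z hz
    rw [mem_closedBall_zero_iff] at hz ⊢
    rw [norm_smul, Real.norm_of_nonneg (by positivity)]
    have : (k / N : ℝ) ≤ 1 := (div_le_one hN0).2 (by exact_mod_cast hk)
    nlinarith [norm_nonneg z]
  have hdist : ∀ k : ℕ, k ≤ N → ∀ z ∈ Metric.closedBall (0 : ℂ) 1,
      ∀ w ∈ Metric.closedBall (0 : ℂ) 1,
      ‖S ((k / N : ℝ) • z) - S ((k / N : ℝ) • w)‖ ≤ K * ‖z - w‖ := by
    intro k hk z hz w hw
    refine (hS.norm_sub_le (hmem k hk z hz) (hmem k hk w hw)).trans ?_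
    rw [← smul_sub, norm_smul, Real.norm_of_nonneg (by positivity)]
    have : (k / N : ℝ) ≤ 1 := (div_le_one hN0).2 (by exact_mod_cast hk)
    gcongr
    nlinarith [norm_nonneg (z - w)]
  -- Homotopy lifting along the contraction of the disk: a lift of z ↦ S((k/N)z) becomes one for k +
  -- 1 on left multiplication by the dihedral quaternion between the two values. At k = 0 the map is
  -- constant.
  have main : ∀ k : ℕ, k ≤ N → ∃ (T : ℂ → ℍ[ℝ]) (L : ℝ),
      (∀ z ∈ Metric.closedBall (0 : ℂ) 1, ∀ w ∈ Metric.closedBall (0 : ℂ) 1,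
        ‖T z - T w‖ ≤ L * ‖z - w‖) ∧
      ∀ z ∈ Metric.closedBall (0 : ℂ) 1, ‖T z‖ = 1 ∧ hopf (T z) = S ((k / N : ℝ) • z) := by
    intro k
    induction k with
    | zero =>
      intro _
      obtain ⟨q, hq, hq'⟩ := exists_hopf_eq (hmaps (Metric.mem_closedBall_self zero_le_one))
      exact ⟨fun _ => q, 0, by simp, by simp [hq, hq']⟩
    | succ k ih =>
      intro hk
      have hk' : k ≤ N := by omega
      obtain ⟨T, L, hT, hT'⟩ := ih hk'
      have hclose : ∀ z ∈ Metric.closedBall (0 : ℂ) 1,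
          ‖S ((k / N : ℝ) • z) - S (((k + 1 : ℕ) / N : ℝ) • z)‖ ≤ 1 := by
        intro z hz
        refine (hS.norm_sub_le (hmem k hk' z hz) (hmem _ hk z hz)).trans ?_
        rw [← sub_smul, norm_smul, ← sub_div, norm_div, Real.norm_of_nonneg hN0.le]
        push_cast
        rw [sub_add_cancel_left, norm_neg, norm_one]
        rw [mem_closedBall_zero_iff] at hz
        calc (K : ℝ) * (1 / N * ‖z‖) ≤ N * (1 / N * 1) := by gcongr
          _ = 1 := by field_simp
      have ha := fun z hz => hmaps (hmem k hk' z hz)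
      have hb := fun z hz => hmaps (hmem (k + 1) hk z hz)
      have hne := fun z hz => ne_neg_of_norm_sub_le_one (ha z hz) (hclose z hz)
      refine ⟨fun z => dihedral (S ((k / N : ℝ) • z)) (S (((k + 1 : ℕ) / N : ℝ) • z)) * T z,
        2 * (K + K) + L, fun z hz w hw => ?_, fun z hz => ⟨?_, ?_⟩⟩
      · refine (norm_mul_sub_mul_le _ _ _ _).trans ?_
        rw [(hT' z hz).1, norm_dihedral (ha w hw) (hb w hw) (hne w hw)]
        have h1 := norm_dihedral_sub_le (ha z hz) (hb z hz) (ha w hw) (hb w hw) (hclose z hz)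
          (hclose w hw)
        linarith [hdist k hk' z hz w hw, hdist (k + 1) hk z hz w hw, hT z hz w hw]
      · rw [norm_mul, norm_dihedral (ha z hz) (hb z hz) (hne z hz), (hT' z hz).1, one_mul]
      · exact hopf_dihedral_mul (ha z hz) (hb z hz) (hne z hz) (hT' z hz).1 (hT' z hz).2
  obtain ⟨T, L, hT, hT'⟩ := main N le_rfl
  refine ⟨T, L.toNNReal, LipschitzOnWith.of_dist_le_mul fun z hz w hw => ?_, fun z hz => ?_⟩
  · rw [dist_eq_norm, dist_eq_norm]
    exact (hT z hz w hw).trans (by gcongr; exact Real.le_coe_toNNReal L)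
  · simpa [div_self hN0.ne'] using hT' z hz

end Lift

/-! ### Pullback of the area form and polar coordinates -/

section Polar

instance : StarModule ℝ ℍ[ℝ] := ⟨fun r x => by ext <;> simp⟩

theorem re_star_mul_of_norm_eq_one {f : ℝ → ℍ[ℝ]} {f' : ℍ[ℝ]} {t : ℝ} (hf : HasDerivAt f f' t)
    (h : ∀ᶠ s in 𝓝 t, ‖f s‖ = 1) : (star (f t) * f').re = 0 := by
  have h1 : HasDerivAt (fun s => star (f s) * f s) (star f' * f t + star (f t) * f') t :=
    hf.star.mul hf
  have h2 : (fun s => star (f s) * f s) =ᶠ[𝓝 t] fun _ => 1 :=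
    h.mono fun s hs => star_mul_of_norm_eq_one hs
  have h3 := h1.unique ((hasDerivAt_const t (1 : ℍ[ℝ])).congr_of_eventuallyEq h2)
  have h4 := congrArg QuaternionAlgebra.re h3
  simp at h4 ⊢
  linarith

/-- Near z, S = T i T̄, so the product rule along lines gives dS in the form required by
`areaForm_hopf`; differentiating T̄T = 1 gives its tangency hypotheses. -/
theorem pullbackArea_eq_of_lift {S T : ℂ → ℍ[ℝ]} {z : ℂ} (hT : DifferentiableAt ℝ T z)
    (h : ∀ᶠ w in 𝓝 z, ‖T w‖ = 1 ∧ hopf (T w) = S w) :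
    pullbackArea S z = -4 * connectionForm (fderiv ℝ T z 1) (fderiv ℝ T z Complex.I) := by
  have line : ∀ v : ℂ, HasDerivAt (fun s : ℝ => T (z + s • v)) (fderiv ℝ T z v) 0 :=
    fun v => hT.hasFDerivAt.hasLineDerivAt v
  have near : ∀ v : ℂ, ∀ᶠ s : ℝ in 𝓝 0, ‖T (z + s • v)‖ = 1 ∧
      hopf (T (z + s • v)) = S (z + s • v) := by
    intro v
    have : Tendsto (fun s : ℝ => z + s • v) (𝓝 0) (𝓝 z) := by
      have : Continuous fun s : ℝ => z + s • v := by fun_prop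
      simpa using this.tendsto 0
    exact this.eventually h
  have hSd : DifferentiableAt ℝ S z := by
    have h1 : DifferentiableAt ℝ (fun w => T w * quatI * star (T w)) z :=
      (hT.mul (differentiableAt_const _)).mul hT.star
    exact h1.congr_of_eventuallyEq (h.mono fun w hw => hw.2.symm)
  have hS : ∀ v : ℂ, fderiv ℝ S z v =
      fderiv ℝ T z v * quatI * star (T z) + T z * quatI * star (fderiv ℝ T z v) := by
    intro v
    have h1 := ((line v).mul_const quatI).mul (line v).star
    simp only [zero_smul, add_zero] at h1
    have h2 : HasDerivAt (fun s : ℝ => S (z + s • v)) (fderiv ℝ S z v) 0 :=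
      hSd.hasFDerivAt.hasLineDerivAt v
    exact h2.unique (h1.congr_of_eventuallyEq ((near v).mono fun s hs => hs.2.symm))
  have hz := h.self_of_nhds
  have hre : ∀ v : ℂ, (star (T z) * fderiv ℝ T z v).re = 0 := by
    intro v
    have := re_star_mul_of_norm_eq_one (line v) ((near v).mono fun s hs => hs.1)
    simpa using this
  rw [pullbackArea, hS, hS, ← hz.2, areaForm_hopf hz.1 (hre _) (hre _)]

/-- Polar coordinates, as a map defined on the whole plane. -/
def polarMap (x : ℝ × ℝ) : ℂ := x.1 • (⟨Real.cos x.2, Real.sin x.2⟩ : ℂ)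

theorem polarCoord_symm_eq_polarMap (x : ℝ × ℝ) : Complex.polarCoord.symm x = polarMap x := by
  rw [Complex.polarCoord_symm_apply, polarMap]
  apply Complex.ext <;> simp [Complex.cos_ofReal_re, Complex.sin_ofReal_re]

theorem polarMap_eq_exp (r t : ℝ) : polarMap (r, t) = r * Complex.exp (t * Complex.I) := by
  rw [polarMap]
  apply Complex.ext <;> simp [Complex.exp_ofReal_mul_I_re, Complex.exp_ofReal_mul_I_im]

theorem hasFDerivAt_polarMap (x : ℝ × ℝ) : ∃ P : ℝ × ℝ →L[ℝ] ℂ, HasFDerivAt polarMap P x ∧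
    P (1, 0) = ⟨Real.cos x.2, Real.sin x.2⟩ ∧
    P (0, 1) = x.1 • (⟨-Real.sin x.2, Real.cos x.2⟩ : ℂ) := by
  have h1 : HasDerivAt (fun t : ℝ => (⟨Real.cos t, Real.sin t⟩ : ℂ))
      ⟨-Real.sin x.2, Real.cos x.2⟩ x.2 := by
    have h := ((Real.hasDerivAt_cos x.2).ofReal_comp).add
      (((Real.hasDerivAt_sin x.2).ofReal_comp).mul_const Complex.I)
    refine (h.congr_deriv ?_).congr_of_eventuallyEq (Eventually.of_forall fun t => ?_)
    · apply Complex.ext <;> simp [Complex.cos_ofReal_re, Complex.sin_ofReal_re]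
    · apply Complex.ext <;> simp [Complex.cos_ofReal_re, Complex.sin_ofReal_re]
  have h2 := (hasFDerivAt_fst (𝕜 := ℝ) (p := x)).smul
    (h1.hasFDerivAt.comp x (hasFDerivAt_snd (𝕜 := ℝ) (p := x)))
  refine ⟨_, h2, ?_, ?_⟩ <;> simp

theorem norm_polarMap (x : ℝ × ℝ) : ‖polarMap x‖ = |x.1| := by
  rw [polarMap_eq_exp, norm_mul, Complex.norm_exp_ofReal_mul_I]; simp

theorem norm_exp_mul_I_sub_le (s t : ℝ) :
    ‖Complex.exp (s * Complex.I) - Complex.exp (t * Complex.I)‖ ≤ |s - t| := by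
  have h : Complex.exp (s * Complex.I) - Complex.exp (t * Complex.I) =
      Complex.exp (t * Complex.I) * (Complex.exp (Complex.I * ((s - t : ℝ) : ℂ)) - 1) := by
    rw [mul_sub, ← Complex.exp_add, mul_one]
    congr 2
    push_cast; ring
  rw [h, norm_mul, Complex.norm_exp_ofReal_mul_I, one_mul]
  exact Real.norm_exp_I_mul_ofReal_sub_one_le

theorem continuous_polarMap : Continuous polarMap := by
  refine Differentiable.continuous (𝕜 := ℝ) fun x => ?_
  obtain ⟨P, hP, -⟩ := hasFDerivAt_polarMap x
  exact hP.differentiableAt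

/-- Polar coordinates preserve negligible sets. -/
theorem ae_polarMap {p : ℂ → Prop} (h : ∀ᵐ z, p z) :
    ∀ᵐ x : ℝ × ℝ, x ∈ polarCoord.target → p (polarMap x) := by
  set N := toMeasurable volume {z | ¬ p z}
  have hN : MeasurableSet N := measurableSet_toMeasurable _ _
  have hN0 : volume N = 0 := (measure_toMeasurable _).trans h
  have h1 := Complex.lintegral_comp_polarCoord_symm (N.indicator 1)
  -- Change of variables gives ∫ r · 1_N(polar) = 0 over r > 0, so the indicator vanishes almost
  -- everywhere.
  rw [lintegral_indicator_one hN, hN0, lintegral_eq_zero_iff] at h1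
  · rw [EventuallyEq, ae_restrict_iff' polarCoord.open_target.measurableSet] at h1
    filter_upwards [h1] with x hx hxt
    have hx0 := hx hxt
    have hpos : 0 < x.1 := hxt.1
    by_contra hcon
    have hxN : polarMap x ∈ N := subset_toMeasurable _ _ hcon
    rw [polarCoord_symm_eq_polarMap, indicator_of_mem hxN] at hx0
    simp at hx0
    linarith
  · simp only [polarCoord_symm_eq_polarMap, smul_eq_mul]
    exact (ENNReal.measurable_ofReal.comp measurable_fst).mul
      ((measurable_one.indicator hN).comp continuous_polarMap.measurable)

/-- A map on the closed disk, in polar coordinates, with the radius truncated to `[0, 1]`. -/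
def polarExtension (T : ℂ → ℍ[ℝ]) (x : ℝ × ℝ) : ℍ[ℝ] := T (polarMap (max 0 (min x.1 1), x.2))

theorem polarMap_truncate_mem (x : ℝ × ℝ) :
    polarMap (max 0 (min x.1 1), x.2) ∈ Metric.closedBall (0 : ℂ) 1 := by
  rw [mem_closedBall_zero_iff, norm_polarMap, abs_of_nonneg (le_max_left _ _)]
  exact max_le zero_le_one (min_le_right _ _)

/-- The factor 2 is one unit for the radius and one for the angle, the latter because the truncated
radius is at most 1. -/
theorem lipschitzWith_polarExtension {T : ℂ → ℍ[ℝ]} {L : NNReal}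
    (hT : LipschitzOnWith L T (Metric.closedBall 0 1)) :
    LipschitzWith (L * 2) (polarExtension T) := by
  refine LipschitzWith.of_dist_le_mul fun x y => ?_
  refine (hT.dist_le_mul _ (polarMap_truncate_mem x) _ (polarMap_truncate_mem y)).trans ?_
  push_cast
  rw [mul_assoc]
  gcongr
  have h1 : |max 0 (min x.1 1) - max 0 (min y.1 1)| ≤ |x.1 - y.1| := by
    refine (abs_max_sub_max_le_max _ _ _ _).trans ?_
    rw [sub_self, abs_zero]
    refine max_le (abs_nonneg _) ((abs_min_sub_min_le_max _ _ _ _).trans ?_)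
    simp
  have h2 : max 0 (min y.1 1) ≤ 1 := max_le zero_le_one (min_le_right _ _)
  have h3 : 0 ≤ max 0 (min y.1 1) := le_max_left _ _
  set r := max 0 (min x.1 1)
  set r' := max 0 (min y.1 1)
  have h4 : polarMap (r, x.2) - polarMap (r', y.2) = ((r - r' : ℝ) : ℂ) *
      Complex.exp (x.2 * Complex.I) + r' * (Complex.exp (x.2 * Complex.I) -
        Complex.exp (y.2 * Complex.I)) := by
    rw [polarMap_eq_exp, polarMap_eq_exp]; push_cast; ring
  rw [dist_eq_norm, h4]
  refine (norm_add_le _ _).trans ?_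
  rw [norm_mul, norm_mul, Complex.norm_exp_ofReal_mul_I, mul_one, Complex.norm_real,
    Complex.norm_real, Real.norm_eq_abs, Real.norm_eq_abs, abs_of_nonneg h3]
  have h5 := norm_exp_mul_I_sub_le x.2 y.2
  have h6 : |x.1 - y.1| ≤ dist x y := le_max_left (dist x.1 y.1) _
  have h7 : |x.2 - y.2| ≤ dist x y := le_max_right _ (dist x.2 y.2)
  nlinarith [norm_nonneg (Complex.exp (x.2 * Complex.I) - Complex.exp (y.2 * Complex.I))]

/-- An alternating form picks up the Jacobian r(cos² + sin²) of polar coordinates. -/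
theorem connectionForm_fderiv_polarExtension {T : ℂ → ℍ[ℝ]} {x : ℝ × ℝ} (h0 : 0 < x.1)
    (h1 : x.1 < 1) (hT : DifferentiableAt ℝ T (polarMap x)) :
    connectionForm (fderiv ℝ (polarExtension T) x (1, 0))
      (fderiv ℝ (polarExtension T) x (0, 1)) =
      x.1 * connectionForm (fderiv ℝ T (polarMap x) 1) (fderiv ℝ T (polarMap x) Complex.I) := by
  obtain ⟨P, hP, hP1, hP2⟩ := hasFDerivAt_polarMap x
  have hev : polarExtension T =ᶠ[𝓝 x] T ∘ polarMap := by
    have : Ioo (0 : ℝ) 1 ×ˢ (univ : Set ℝ) ∈ 𝓝 x :=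
      (isOpen_Ioo.prod isOpen_univ).mem_nhds ⟨⟨h0, h1⟩, mem_univ _⟩
    filter_upwards [this] with y hy
    rw [polarExtension, min_eq_left hy.1.2.le, max_eq_right hy.1.1.le]; rfl
  have hF := ((hT.hasFDerivAt.comp x hP).congr_of_eventuallyEq hev).fderiv
  have e : ∀ c s : ℝ, (⟨c, s⟩ : ℂ) = c • (1 : ℂ) + s • Complex.I := by
    intro c s; apply Complex.ext <;> simp
  rw [hF, ContinuousLinearMap.comp_apply, ContinuousLinearMap.comp_apply, hP1, hP2, e, e]
  set D := fderiv ℝ T (polarMap x)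
  have a1 : ∀ u, connectionForm u u = 0 := fun u => by linarith [connectionForm_antisymm u u]
  simp only [map_add, map_smul, add_apply, smul_apply, smul_eq_mul, a1,
    connectionForm_antisymm (D Complex.I) (D 1)]
  linear_combination x.1 * connectionForm (D 1) (D Complex.I) * Real.sin_sq_add_cos_sq x.2

theorem integral_ball_connectionForm {T : ℂ → ℍ[ℝ]} {L : NNReal}
    (hT : LipschitzOnWith L T (Metric.closedBall 0 1)) :
    ∫ x in Ioc (-1 : ℝ) 1 ×ˢ Ioc (-Real.pi) (-Real.pi + 2 * Real.pi),
      connectionForm (fderiv ℝ (polarExtension T) x (1, 0))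
        (fderiv ℝ (polarExtension T) x (0, 1)) =
    ∫ z in Metric.ball (0 : ℂ) 1,
      connectionForm (fderiv ℝ T z 1) (fderiv ℝ T z Complex.I) := by
  have hdiff : ∀ᵐ z : ℂ, z ∈ Metric.ball (0 : ℂ) 1 → DifferentiableAt ℝ T z := by
    have := (hT.mono Metric.ball_subset_closedBall).ae_differentiableWithinAt (μ := volume)
      Metric.isOpen_ball.measurableSet
    rw [ae_restrict_iff' Metric.isOpen_ball.measurableSet] at this
    filter_upwards [this] with z hz hzb
    exact (hz hzb).differentiableAt (Metric.isOpen_ball.mem_nhds hzb)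
  rw [← integral_indicator Metric.isOpen_ball.measurableSet,
    ← Complex.integral_comp_polarCoord_symm,
    ← integral_indicator polarCoord.open_target.measurableSet,
    ← integral_indicator (measurableSet_Ioc.prod measurableSet_Ioc)]
  refine integral_congr_ae ?_
  have ne1 : ∀ a : ℝ, ∀ᵐ x : ℝ × ℝ, x.1 ≠ a := fun a =>
    Measure.quasiMeasurePreserving_fst.ae (Measure.ae_ne volume a)
  have ne2 : ∀ a : ℝ, ∀ᵐ x : ℝ × ℝ, x.2 ≠ a := fun a =>
    Measure.quasiMeasurePreserving_snd.ae (Measure.ae_ne volume a)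
  filter_upwards [ae_polarMap hdiff, ne1 0, ne1 1, ne2 Real.pi] with x hx n0 n1 n2
  simp only [polarCoord_symm_eq_polarMap]
  rw [show -Real.pi + 2 * Real.pi = Real.pi by ring]
  by_cases h2 : x.2 ∈ Ioo (-Real.pi) Real.pi
  · rcases lt_trichotomy x.1 0 with h | h | h
    · rw [indicator_of_notMem (s := polarCoord.target) (fun hc => not_lt_of_gt h hc.1)]
      -- The added strip r < 0 contributes nothing, the extension being constant there.
      have hF : polarExtension T =ᶠ[𝓝 x] fun _ => T 0 := by
        have : Iio (0 : ℝ) ×ˢ (univ : Set ℝ) ∈ 𝓝 x :=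
          (isOpen_Iio.prod isOpen_univ).mem_nhds ⟨h, mem_univ _⟩
        filter_upwards [this] with y hy
        rw [polarExtension, max_eq_left ((min_le_left _ _).trans (le_of_lt hy.1)), polarMap,
          zero_smul]
      apply indicator_apply_eq_zero.2
      rw [hF.fderiv_eq]
      simp
    · exact absurd h n0
    · have hxt : x ∈ polarCoord.target := ⟨h, h2⟩
      rw [indicator_of_mem hxt]
      rcases lt_or_gt_of_ne n1 with h1 | h1
      · have hb : polarMap x ∈ Metric.ball (0 : ℂ) 1 := by
          rw [mem_ball_zero_iff, norm_polarMap, abs_of_pos h]; exact h1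
        rw [indicator_of_mem hb, indicator_of_mem, smul_eq_mul,
          connectionForm_fderiv_polarExtension h h1 (hx hxt hb)]
        exact ⟨⟨by linarith, h1.le⟩, h2.1, h2.2.le⟩
      · rw [indicator_of_notMem, indicator_of_notMem, smul_zero]
        · rw [mem_ball_zero_iff, norm_polarMap, abs_of_pos h]; exact not_lt_of_gt h1
        · exact fun hc => not_lt_of_ge hc.1.2 h1
  · rw [indicator_of_notMem (s := polarCoord.target) (fun hc => h2 hc.2), indicator_of_notMem]
    exact fun hc => h2 ⟨hc.2.1, lt_of_le_of_ne hc.2.2 n2⟩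

/-- The signed area of a disk on the sphere is minus twice the integral of the connection form along
a lift of the boundary. -/
theorem regionArea_eq_boundary_integral {S T : ℂ → ℍ[ℝ]} {L : NNReal}
    (hT : LipschitzOnWith L T (Metric.closedBall 0 1))
    (h : ∀ z ∈ Metric.closedBall (0 : ℂ) 1, ‖T z‖ = 1 ∧ hopf (T z) = S z) :
    regionArea S = -2 * ∫ t in (0 : ℝ)..2 * Real.pi,
      connectionForm (T (Complex.exp (t * Complex.I)))
        (deriv (fun s : ℝ => T (Complex.exp (s * Complex.I))) t) := by
  have hS := two_mul_integral_antisymm_fderiv connectionForm (a := -Real.pi) (T := 2 * Real.pi)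
    connectionForm_antisymm (lipschitzWith_polarExtension hT) Real.two_pi_pos.le
    (fun r t => by simp [polarExtension, polarMap])
    (fun r t hr => by simp [polarExtension, hr])
    (fun r t hr => by simp [polarExtension, polarMap, min_le_of_left_le hr])
  have h1 : ∀ s : ℝ, polarExtension T (1, s) = T (Complex.exp (s * Complex.I)) := fun s => by
    simp [polarExtension, polarMap_eq_exp]
  -- Polar coordinates use angles in (-π, π); periodicity moves the boundary integral to [0, 2π].
  have hp : Function.Periodic (fun t : ℝ => connectionForm (T (Complex.exp (t * Complex.I)))
        (deriv (fun s : ℝ => T (Complex.exp (s * Complex.I))) t)) (2 * Real.pi) := by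
    have h2 : Function.Periodic (fun s : ℝ => T (Complex.exp (s * Complex.I))) (2 * Real.pi) := by
      intro s
      push_cast
      rw [add_mul, Complex.exp_periodic]
    intro t
    have h3 := deriv_comp_add_const (fun s : ℝ => T (Complex.exp (s * Complex.I))) (2 * Real.pi) t
    rw [funext h2] at h3
    simp only [← h3]
    congr 2
    exact h2 t
  simp only [h1] at hS
  rw [integral_ball_connectionForm hT, hp.intervalIntegral_add_eq (-Real.pi) 0, zero_add] at hS
  rw [← hS, regionArea, ← mul_assoc, ← integral_const_mul]
  have hdiff := (hT.mono Metric.ball_subset_closedBall).ae_differentiableWithinAt (μ := volume)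
      Metric.isOpen_ball.measurableSet
  refine integral_congr_ae ?_
  filter_upwards [hdiff, ae_restrict_mem Metric.isOpen_ball.measurableSet] with z hz hzb
  rw [pullbackArea_eq_of_lift (hz.differentiableAt (Metric.isOpen_ball.mem_nhds hzb))
    ((Metric.isOpen_ball.eventually_mem hzb).mono fun w hw =>
      h w (Metric.ball_subset_closedBall hw))]
  norm_num

end Polar

/-! ### Rotation of a lift relative to a horizontal lift -/

section Holonomy

theorem abs_connectionForm_le (u v : ℍ[ℝ]) : |connectionForm u v| ≤ ‖u‖ * ‖v‖ := by
  have h := abs_imI_le_norm (star u * v)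
  rwa [norm_mul, norm_star] at h

theorem hasDerivAt_coeComplex {f : ℝ → ℂ} {f' : ℂ} {t : ℝ} (hf : HasDerivAt f f' t) :
    HasDerivAt (fun s => (f s : ℍ[ℝ])) (f' : ℍ[ℝ]) t :=
  (Quaternion.ofComplex.toLinearMap.toContinuousLinearMap.hasFDerivAt (x := f t)).comp_hasDerivAt
    t hf

theorem abs_connectionForm_deriv_le {g : ℝ → ℍ[ℝ]} {L : NNReal} (hg : LipschitzWith L g)
    (hg1 : ∀ t, ‖g t‖ = 1) (t : ℝ) : |connectionForm (g t) (deriv g t)| ≤ L := by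
  refine (abs_connectionForm_le _ _).trans ?_
  rw [hg1, one_mul]
  exact norm_deriv_le_of_lipschitz hg

theorem intervalIntegrable_connectionForm_deriv {g : ℝ → ℍ[ℝ]} {L : NNReal}
    (hg : LipschitzWith L g) (hg1 : ∀ t, ‖g t‖ = 1) (a b : ℝ) :
    IntervalIntegrable (fun t => connectionForm (g t) (deriv g t)) volume a b := by
  refine (intervalIntegrable_const (c := (L : ℝ))).mono_fun ?_ ?_
  · have h1 : AEStronglyMeasurable g (volume.restrict (uIoc a b)) :=
      hg.continuous.aestronglyMeasurable
    have h2 : AEStronglyMeasurable (deriv g) (volume.restrict (uIoc a b)) := by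
      exact aestronglyMeasurable_deriv _ _
    have cB : Continuous fun p : ℍ[ℝ] × ℍ[ℝ] => connectionForm p.1 p.2 := by fun_prop
    exact Continuous.comp_aestronglyMeasurable (f := fun t => (g t, deriv g t)) cB
      (h1.prodMk h2)
  · refine Eventually.of_forall fun t => ?_
    simpa using abs_connectionForm_deriv_le hg hg1 t

theorem eq_coeComplex_mul_I {w : ℍ[ℝ]} (h0 : w.re = 0) (hJ : w.imJ = 0) (hK : w.imK = 0) :
    w = (((w.imI : ℝ) * Complex.I : ℂ) : ℍ[ℝ]) := by
  ext <;> simp [h0, hJ, hK]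

/-- If `g` and `H` lie over the same curve on the 2-sphere and `H` is horizontal, then the vertical
component of `g` relative to `H` rotates at the rate given by the connection form. -/
theorem hasDerivAt_star_mul_of_horizontal {g H : ℝ → ℍ[ℝ]} {g' H' : ℍ[ℝ]} {t : ℝ}
    (hg : HasDerivAt g g' t) (hH : HasDerivAt H H' t)
    (h : ∀ᶠ s in 𝓝 t, ‖g s‖ = 1 ∧ ‖H s‖ = 1 ∧ hopf (H s) = hopf (g s))
    (hhor : connectionForm (H t) H' = 0) :
    HasDerivAt (fun s => star (H s) * g s)
      (star (H t) * g t * (((connectionForm (g t) g' : ℝ) * Complex.I : ℂ) : ℍ[ℝ])) t := by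
  have hu := hH.star.mul hg
  set x := star (H t) * g t with hx
  set x' := star H' * g t + star (H t) * g' with hx'
  obtain ⟨hgt, hHt, hhopf⟩ := h.self_of_nhds
  have hx1 : ‖x‖ = 1 := by rw [hx, norm_mul, norm_star, hgt, hHt, one_mul]
  have hre : (star x * x').re = 0 := re_star_mul_of_norm_eq_one
    (f := fun s => star (H s) * g s) hu (h.mono fun s hs => by
    rw [norm_mul, norm_star, hs.1, hs.2.1, one_mul])
  have hxi : x * quatI = quatI * x := star_mul_commute hHt hgt hhopf
  -- Differentiating the commutation relation shows that x' is complex as well as x.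
  have hx'i : x' * quatI = quatI * x' := by
    have h1 := (hu.mul_const quatI).unique ((hu.const_mul quatI).congr_of_eventuallyEq
      (h.mono fun s hs => star_mul_commute hs.2.1 hs.1 hs.2.2))
    exact h1
  obtain ⟨xJ, xK⟩ := imJ_imK_eq_zero_of_commute hxi
  obtain ⟨x'J, x'K⟩ := imJ_imK_eq_zero_of_commute hx'i
  have hG : g t = H t * x := by
    rw [hx, ← mul_assoc, mul_star_of_norm_eq_one hHt, one_mul]
  have hy0 : (star H' * H t).imI = 0 := by
    rw [connectionForm_apply] at hhor
    have : star H' * H t = star (star (H t) * H') := by rw [star_mul, star_star]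
    rw [this, Quaternion.imI_star, hhor, neg_zero]
  have hI : (star x * x').imI = connectionForm (g t) g' := by
    have e : star x * x' = star x * (star H' * H t) * x + star (g t) * g' := by
      have e1 : star x * star (H t) = star (g t) := by
        rw [hx, star_mul, star_star, mul_assoc, mul_star_of_norm_eq_one hHt, mul_one]
      rw [hx', mul_add, ← mul_assoc (star x) (star (H t)), e1, hG]
      noncomm_ring
    -- Horizontality kills the i-component of H̄'H, and conjugation by the complex number x does not
    -- create one.
    have e2 : (star x * (star H' * H t) * x).imI = 0 := by
      set y := star H' * H t
      simp only [Quaternion.imI_mul, Quaternion.re_mul, Quaternion.imJ_mul, Quaternion.imK_mul,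
        Quaternion.re_star, Quaternion.imI_star, Quaternion.imJ_star, Quaternion.imK_star, hy0,
        xJ, xK]
      ring
    rw [e, Quaternion.imI_add, e2, zero_add, connectionForm_apply]
  have key := eq_coeComplex_mul_I (w := star x * x') hre (by simp [xJ, xK, x'J, x'K])
    (by simp [xJ, xK, x'J, x'K])
  rw [hI] at key
  rw [← key, ← mul_assoc, mul_star_of_norm_eq_one hx1, one_mul]
  exact hu

/-- H̄ g e^{-iA}, with A the primitive of the connection form, has zero derivative almost
everywhere. As g is merely Lipschitz this does not suffice alone; the product is Lipschitz, hence
absolutely continuous, hence constant. -/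
theorem star_mul_eq_mul_exp_of_horizontal {g H : ℝ → ℍ[ℝ]} {L : NNReal} {a b : ℝ} (hab : a ≤ b)
    (hg : LipschitzWith L g) (hg1 : ∀ t, ‖g t‖ = 1) (hH : ContDiff ℝ 1 H) (hH1 : ∀ t, ‖H t‖ = 1)
    (hhor : ∀ t, connectionForm (H t) (deriv H t) = 0)
    (h : ∀ t ∈ Ioo a b, hopf (H t) = hopf (g t)) :
    star (H b) * g b = star (H a) * g a *
      ((Complex.exp ((∫ t in a..b, connectionForm (g t) (deriv g t) : ℝ) * Complex.I) : ℂ) :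
        ℍ[ℝ]) := by
  set α := fun t => connectionForm (g t) (deriv g t) with hα
  set A : ℝ → ℝ := fun x => ∫ t in a..x, α t with hA
  have hint := intervalIntegrable_connectionForm_deriv hg hg1
  set e : ℝ → ℂ := fun t => Complex.exp (((-A t : ℝ) : ℂ) * Complex.I) with he
  have he1 : ∀ t, ‖(e t : ℍ[ℝ])‖ = 1 := fun t => by
    rw [norm_coeComplex, he, Complex.norm_exp_ofReal_mul_I]
  have heL : ∀ s t, ‖(e s : ℍ[ℝ]) - (e t : ℍ[ℝ])‖ ≤ L * ‖s - t‖ := by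
    intro s t
    have h1 : (e s : ℍ[ℝ]) - (e t : ℍ[ℝ]) = ((e s - e t : ℂ) : ℍ[ℝ]) := by ext <;> simp
    rw [h1, norm_coeComplex]
    refine (norm_exp_mul_I_sub_le _ _).trans ?_
    have h2 : -A s - -A t = ∫ x in s..t, α x := by
      rw [← intervalIntegral.integral_interval_sub_left (hint a t) (hint a s)]; ring
    rw [h2, ← Real.norm_eq_abs, norm_sub_rev s t]
    exact intervalIntegral.norm_integral_le_of_norm_le_const fun x _ =>
      abs_connectionForm_deriv_le hg hg1 x
  obtain ⟨C, hC⟩ := hH.contDiffOn.exists_lipschitzOnWith one_ne_zero (convex_uIcc a b)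
    isCompact_uIcc
  have hAC : AbsolutelyContinuousOnInterval (fun t => star (H t) * g t * (e t : ℍ[ℝ])) a b := by
    refine LipschitzOnWith.absolutelyContinuousOnInterval (K := C + L + L)
      (LipschitzOnWith.of_dist_le_mul fun s hs t ht => ?_)
    rw [dist_eq_norm, dist_eq_norm]
    have h1 := norm_mul_sub_mul_le (star (H s) * g s) (e s : ℍ[ℝ]) (star (H t) * g t) (e t)
    have h2 := norm_mul_sub_mul_le (star (H s)) (g s) (star (H t)) (g t)
    rw [← star_sub] at h2
    simp only [norm_mul, norm_star, hg1, hH1, he1, one_mul, mul_one] at h1 h2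
    push_cast
    linarith [heL s t, hC.norm_sub_le hs ht, hg.norm_sub_le s t]
  obtain ⟨c, hc⟩ := hAC.const_of_ae_hasDerivAt_zero (by
    have hne : ∀ x : ℝ, ∀ᵐ t : ℝ, t ≠ x := fun x => Measure.ae_ne volume x
    filter_upwards [hg.ae_differentiableAt_real, (hint a b).ae_hasDerivAt_integral, hne a, hne b]
      with t htg htA hta htb htab
    have hA' : HasDerivAt A (α t) t := htA htab a left_mem_uIcc
    rw [uIcc_of_le hab] at htab
    have htI : t ∈ Ioo a b :=
      ⟨lt_of_le_of_ne htab.1 (Ne.symm hta), lt_of_le_of_ne htab.2 htb⟩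
    have hHt : HasDerivAt H (deriv H t) t :=
      ((hH.differentiable one_ne_zero) t).hasDerivAt
    have h1 := hasDerivAt_star_mul_of_horizontal htg.hasDerivAt hHt
      ((isOpen_Ioo.eventually_mem htI).mono fun s hs => ⟨hg1 s, hH1 s, h s hs⟩) (hhor t)
    have h2 : HasDerivAt e (e t * (((-α t : ℝ) : ℂ) * Complex.I)) t :=
      (hA'.neg.ofReal_comp.mul_const Complex.I).cexp
    refine (h1.mul (hasDerivAt_coeComplex h2)).congr_deriv ?_
    rw [mul_assoc, ← mul_add, ← Quaternion.coeComplex_mul, ← Quaternion.coeComplex_add]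
    have : ((connectionForm (g t) (deriv g t) : ℝ) : ℂ) * Complex.I * e t +
        e t * (((-α t : ℝ) : ℂ) * Complex.I) = 0 := by
      rw [hα]; push_cast; ring
    rw [this, Quaternion.coeComplex_zero, mul_zero])
  have hfin := (hc b right_mem_uIcc).trans (hc a left_mem_uIcc).symm
  simp only [he, hA, intervalIntegral.integral_same, neg_zero, Complex.ofReal_zero, zero_mul,
    Complex.exp_zero, Quaternion.coeComplex_one, mul_one] at hfin
  rw [← hfin, mul_assoc, ← Quaternion.coeComplex_mul, ← Complex.exp_add, Complex.ofReal_neg,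
    neg_mul, neg_add_cancel, Complex.exp_zero, Quaternion.coeComplex_one, mul_one]

end Holonomy

/-! ### Horizontal lifts of great-circle arcs -/

section Arc

theorem mul_eq_neg_mul_of_inner_eq_zero {p u : ℍ[ℝ]} (hp : p.re = 0) (hu : u.re = 0)
    (h : inner ℝ p u = 0) : u * p = -(p * u) := by
  rw [Quaternion.inner_def] at h
  simp [hp, hu] at h
  ext <;> simp [hp, hu] <;> linarith

/-- The horizontal lift of a great circle on the 2-sphere. -/
theorem exists_horizontal_lift_circle {p u q : ℍ[ℝ]} (hp : p ∈ sphereTwo) (hu : u ∈ sphereTwo)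
    (hpu : inner ℝ p u = 0) (hq : ‖q‖ = 1) (hpq : hopf q = p) (ω a : ℝ) :
    ∃ H : ℝ → ℍ[ℝ], ContDiff ℝ 1 H ∧ (∀ t, ‖H t‖ = 1) ∧
      (∀ t, connectionForm (H t) (deriv H t) = 0) ∧
      (∀ t, hopf (H t) = Real.cos ((t - a) * ω) • p + Real.sin ((t - a) * ω) • u) ∧
      ∀ t, H t = (Real.cos ((t - a) * ω / 2) • (1 : ℍ[ℝ]) +
        Real.sin ((t - a) * ω / 2) • (p * u)) * q := by
  have hpp := mul_self_of_mem_sphereTwo hp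
  have huu := mul_self_of_mem_sphereTwo hu
  have hup := mul_eq_neg_mul_of_inner_eq_zero hp.1 hu.1 hpu
  set m := p * u with hm
  have hmp : m * p = u := by rw [hm, mul_assoc, hup, mul_neg, hm, ← mul_assoc, hpp]; simp
  have hum : u * m = p := by rw [hm, ← mul_assoc, hup, hm, neg_mul, mul_assoc, huu]; simp
  have hpm : p * m = -u := by rw [hm, ← mul_assoc, hpp]; simp
  have hmm : m * m = -1 := by nth_rewrite 2 [hm]; rw [← mul_assoc, hmp, huu]
  have hms : star m = -m := by
    rw [hm, star_mul, star_of_re_eq_zero hp.1, star_of_re_eq_zero hu.1, neg_mul_neg, hup]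
  -- Since m² = -1, R φ is e^{mφ}. As pm = -mp, conjugating p by it rotates p towards u by the angle
  -- 2φ, whence the half angles.
  set R : ℝ → ℍ[ℝ] := fun φ => Real.cos φ • (1 : ℍ[ℝ]) + Real.sin φ • m with hR
  have hRstar : ∀ φ, star (R φ) = Real.cos φ • (1 : ℍ[ℝ]) - Real.sin φ • m := by
    intro φ; simp [hR, hms, sub_eq_add_neg]
  have hRR : ∀ φ, star (R φ) * R φ = 1 := by
    intro φ
    rw [hRstar, hR]
    simp only [sub_mul, mul_add, smul_mul_assoc, mul_smul_comm, one_mul, mul_one, hmm]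
    linear_combination (norm := module) (Real.sin_sq_add_cos_sq φ) • (1 : ℍ[ℝ])
  have hRn : ∀ φ, ‖R φ‖ = 1 := by
    intro φ
    have h1 : ‖R φ‖ * ‖R φ‖ = 1 := by
      rw [← norm_one (α := ℍ[ℝ]), ← hRR φ, norm_mul, norm_star]
    nlinarith [norm_nonneg (R φ)]
  have hderiv : ∀ t, HasDerivAt (fun t => R ((t - a) * ω / 2) * q)
      ((ω / 2) • (m * R ((t - a) * ω / 2) * q)) t := by
    intro t
    have h0 : HasDerivAt (fun t : ℝ => (t - a) * ω / 2) (ω / 2) t := by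
      simpa using (((hasDerivAt_id t).sub_const a).mul_const ω).div_const 2
    have h1 := ((h0.cos.smul_const (1 : ℍ[ℝ])).add (h0.sin.smul_const m)).mul_const q
    refine h1.congr_deriv ?_
    rw [← smul_mul_assoc (ω / 2), hR]
    congr 1
    simp only [mul_add, mul_smul_comm, mul_one, hmm]
    module
  refine ⟨fun t => R ((t - a) * ω / 2) * q, ?_, fun t => ?_, fun t => ?_, fun t => ?_,
    fun t => rfl⟩
  · simp only [hR]
    fun_prop
  · rw [norm_mul, hRn, hq, one_mul]
  -- H̄H' is a multiple of q̄ m q, whose i-component is -Re(q̄ m q i) = -Re(q̄ m p q) = -Re(q̄ u q)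
  -- = -Re u = 0.
  · rw [(hderiv t).deriv, map_smul, connectionForm_apply]
    set φ := (t - a) * ω / 2
    have hmR : m * R φ = R φ * m := by simp [hR, mul_add, add_mul]
    have h1 : star (R φ * q) * (m * R φ * q) = star q * m * q := by
      rw [hmR, star_mul]
      calc star q * star (R φ) * (R φ * m * q) = star q * (star (R φ) * R φ) * (m * q) := by
            noncomm_ring
        _ = star q * m * q := by rw [hRR]; noncomm_ring
    have h2 : ∀ y : ℍ[ℝ], y.imI = -(y * quatI).re := by intro y; simp
    have h3 : (star q * m * q * quatI) = star q * u * q := by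
      rw [mul_assoc, mul_quatI hq, hpq, ← hmp]; noncomm_ring
    have h4 : (star q * u * q).re = (star q * q).re * u.re := by simp; ring
    rw [h1, h2, h3, h4, hu.1]; simp
  · apply hopf_eq_of_mul_quatI (by rw [norm_mul, hRn, hq, one_mul])
    rw [mul_assoc, mul_quatI hq, hpq, ← mul_assoc, ← mul_assoc]
    congr 1
    have hφ : (t - a) * ω = 2 * ((t - a) * ω / 2) := by ring
    rw [hφ, mul_div_cancel_left₀ _ (two_ne_zero' ℝ)]
    set φ := (t - a) * ω / 2
    have hc : Real.cos φ = Real.cos (2 * φ) * Real.cos φ + Real.sin (2 * φ) * Real.sin φ := by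
      rw [← Real.cos_sub]; congr 1; ring
    have hs : Real.sin φ = Real.sin (2 * φ) * Real.cos φ - Real.cos (2 * φ) * Real.sin φ := by
      rw [← Real.sin_sub]; congr 1; ring
    simp only [hR, add_mul, mul_add, smul_mul_assoc, mul_smul_comm, one_mul, mul_one, hmp, hum, hpm]
    linear_combination (norm := module) hc • p + hs • u

theorem shortestArc_self {p : ℍ[ℝ]} (hp : p ∈ sphereTwo) (t : ℝ) : shortestArc p p t = p := by
  simp [shortestArc, hp.2]

theorem abs_inner_lt_one {p p' : ℍ[ℝ]} (hp : p ∈ sphereTwo) (hp' : p' ∈ sphereTwo)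
    (h : p' ≠ -p) (hne : p ≠ p') : |inner ℝ p p'| < 1 := by
  have h1 : 0 < ‖p + p'‖ := norm_pos_iff.2 fun h' => h (eq_neg_of_add_eq_zero_right h')
  have h2 : 0 < ‖p - p'‖ := norm_pos_iff.2 (sub_ne_zero.2 hne)
  have h3 := norm_add_sq_real p p'
  have h4 := norm_sub_sq_real p p'
  rw [hp.2, hp'.2] at h3 h4
  rw [abs_lt]
  constructor <;> nlinarith

/-- The data of a non-constant shortest arc: its angle and its unit initial tangent vector. -/
theorem exists_shortestArc_eq {p p' : ℍ[ℝ]} (hp : p ∈ sphereTwo) (hp' : p' ∈ sphereTwo)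
    (h : p' ≠ -p) (hne : p ≠ p') : ∃ (ω : ℝ) (u : ℍ[ℝ]), 0 ≤ ω ∧ ω < Real.pi ∧ u ∈ sphereTwo ∧
      inner ℝ p u = 0 ∧ p' = Real.cos ω • p + Real.sin ω • u ∧
      ∀ t, shortestArc p p' t = Real.cos (t * ω) • p + Real.sin (t * ω) • u := by
  set c : ℝ := inner ℝ p p' with hc
  obtain ⟨hc1, hc2⟩ := abs_lt.1 (abs_inner_lt_one hp hp' h hne)
  set w := p' - c • p with hw
  have hpp : (inner ℝ p p : ℝ) = 1 := by rw [real_inner_self_eq_norm_sq, hp.2]; norm_num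
  have hwn : ‖w‖ ^ 2 = 1 - c ^ 2 := by
    rw [hw, norm_sub_sq_real, inner_smul_right, real_inner_comm, ← hc, norm_smul, hp.2, hp'.2,
      Real.norm_eq_abs, mul_one, sq_abs]
    ring
  have hwn' : ‖w‖ = Real.sin (Real.arccos c) := by
    rw [Real.sin_arccos, ← hwn, Real.sqrt_sq (norm_nonneg w)]
  have hw0 : ‖w‖ ≠ 0 := by
    intro h0
    rw [h0] at hwn
    nlinarith
  refine ⟨Real.arccos c, ‖w‖⁻¹ • w, Real.arccos_nonneg c, ?_, ⟨?_, ?_⟩, ?_, ?_, fun t => rfl⟩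
  · refine lt_of_le_of_ne (Real.arccos_le_pi c) fun h => ?_
    exact absurd (Real.arccos_eq_pi.1 h) (not_le.2 hc1)
  · simp [hw, hp.1, hp'.1]
  · rw [norm_smul, norm_inv, norm_norm, inv_mul_cancel₀ hw0]
  · rw [inner_smul_right, hw, inner_sub_right, inner_smul_right, hpp, ← hc]; simp
  · rw [← hwn', smul_smul, mul_inv_cancel₀ hw0, Real.cos_arccos hc1.le hc2.le, one_smul, hw]; abel

/-- The horizontal lift of a shortest arc: its endpoint is given by the dihedral quaternion. -/
theorem exists_horizontal_lift_shortestArc {p p' q : ℍ[ℝ]} (hp : p ∈ sphereTwo)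
    (hp' : p' ∈ sphereTwo) (h : p' ≠ -p) (hq : ‖q‖ = 1) (hpq : hopf q = p) (a : ℝ) :
    ∃ H : ℝ → ℍ[ℝ], ContDiff ℝ 1 H ∧ (∀ t, ‖H t‖ = 1) ∧
      (∀ t, connectionForm (H t) (deriv H t) = 0) ∧
      (∀ t, hopf (H t) = shortestArc p p' (t - a)) ∧ H a = q ∧ H (a + 1) = dihedral p p' * q := by
  rcases eq_or_ne p p' with rfl | hne
  · refine ⟨fun _ => q, contDiff_const, fun _ => hq, fun t => by simp, fun t => ?_, rfl, ?_⟩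
    · rw [shortestArc_self hp, hpq]
    · rw [dihedral_self hp, one_mul]
  obtain ⟨ω, u, hω0, hωπ, hu, hpu, hp'u, harc⟩ := exists_shortestArc_eq hp hp' h hne
  obtain ⟨H, h1, h2, h3, h4, h5⟩ := exists_horizontal_lift_circle hp hu hpu hq hpq ω a
  refine ⟨H, h1, h2, h3, fun t => by rw [h4, harc], by simp [h5], ?_⟩
  rw [h5, dihedral_eq_smul hp hp' h]
  congr 1
  have hcos : 0 < Real.cos (ω / 2) := Real.cos_pos_of_mem_Ioo ⟨by linarith, by linarith⟩
  have hup := mul_eq_neg_mul_of_inner_eq_zero hp.1 hu.1 hpu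
  -- Half-angle formulas exhibit 1 - p'p as 2cos(ω/2) e^{mω/2} with m = pu; ω < π makes the factor
  -- positive, so normalizing removes it.
  have hmul : 1 - p' * p = (2 * Real.cos (ω / 2)) •
      (Real.cos (ω / 2) • (1 : ℍ[ℝ]) + Real.sin (ω / 2) • (p * u)) := by
    have e1 : Real.cos ω = 2 * Real.cos (ω / 2) ^ 2 - 1 := by
      rw [← Real.cos_two_mul]; congr 1; ring
    have e2 : Real.sin ω = 2 * Real.sin (ω / 2) * Real.cos (ω / 2) := by
      rw [← Real.sin_two_mul]; congr 1; ring
    rw [hp'u, add_mul, smul_mul_assoc, smul_mul_assoc, mul_self_of_mem_sphereTwo hp, hup, e1, e2]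
    module
  have hnorm : ‖p + p'‖ = 2 * Real.cos (ω / 2) := by
    have e := norm_add_sq_of_mem_sphereTwo hp hp'
    have e1 : (inner ℝ p p' : ℝ) = Real.cos ω := by
      rw [hp'u, inner_add_right, inner_smul_right, inner_smul_right, hpu,
        real_inner_self_eq_norm_sq, hp.2]
      ring
    have e2 : Real.cos ω = 2 * Real.cos (ω / 2) ^ 2 - 1 := by
      rw [← Real.cos_two_mul]; congr 1; ring
    rw [e1, e2] at e
    have e3 : (‖p + p'‖ - 2 * Real.cos (ω / 2)) * (‖p + p'‖ + 2 * Real.cos (ω / 2)) = 0 := by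
      linarith
    rcases mul_eq_zero.1 e3 with e4 | e4
    · linarith
    · linarith [norm_nonneg (p + p')]
  rw [hmul, hnorm, smul_smul, inv_mul_cancel₀ (by positivity), one_smul, add_sub_cancel_left,
    one_mul]

end Arc

/-! ### The area formula and integrability -/

section AreaFormula

variable {n : ℕ} [NeZero n] {p q : ZMod n → ℍ[ℝ]}

theorem closedPath_div (x : ℝ) : closedPath p (x / n) =
    shortestArc (p (⌊x⌋ : ℤ)) (p ((⌊x⌋ : ℤ) + 1)) (Int.fract x) := by
  have hn : (n : ℝ) ≠ 0 := Nat.cast_ne_zero.2 (NeZero.ne n)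
  rw [closedPath, mul_div_cancel₀ _ hn]

theorem closedPath_div_of_mem {k : ℕ} {x : ℝ} (hx : x ∈ Ico (k : ℝ) (k + 1)) :
    closedPath p (x / n) = shortestArc (p k) (p (k + 1)) (x - k) := by
  have h : ⌊x⌋ = k := by rw [Int.floor_eq_iff]; exact_mod_cast hx
  rw [closedPath_div, Int.fract, h]
  simp

theorem sum_range_natCast_eq_sum_zmod {M : Type*} [AddCommMonoid M] (f : ZMod n → M) :
    ∑ k ∈ Finset.range n, f k = ∑ i, f i := by
  refine Finset.sum_bij (fun k _ => (k : ZMod n)) (fun _ _ => Finset.mem_univ _) ?_ ?_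
    fun _ _ => rfl
  · intro a ha b hb hab
    have := congrArg ZMod.val hab
    rwa [ZMod.val_natCast_of_lt (Finset.mem_range.1 ha),
      ZMod.val_natCast_of_lt (Finset.mem_range.1 hb)] at this
  · intro i _
    exact ⟨i.val, Finset.mem_range.2 (ZMod.val_lt i), ZMod.natCast_zmod_val i⟩

theorem star_mul_dihedral_mul_eq {n : ℕ} {p q : ZMod n → ℍ[ℝ]} (hp : ∀ i, p i ∈ sphereTwo) (hanti : ∀ i, p (i + 1) ≠ -p i)
    (hq : ∀ i, q i ∈ sphereThree) (hlift : ∀ i, hopf (q i) = p i) (i : ZMod n) :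
    star (q (i + 1)) * dihedral (p i) (p (i + 1)) * q i =
      ((Complex.exp ((quatArg (star (q (i + 1)) * dihedral (p i) (p (i + 1)) * q i) : ℝ) *
        Complex.I) : ℂ) : ℍ[ℝ]) := by
  have hq1 := fun i => norm_of_mem_sphereThree (hq i)
  have hd := norm_dihedral (hp i) (hp (i + 1)) (hanti i)
  apply eq_exp_quatArg
  · rw [norm_mul, norm_mul, norm_star, hq1, hq1, hd]; norm_num
  · rw [mul_assoc (star _)]
    apply star_mul_commute (hq1 _)
    · rw [norm_mul, hd, hq1, one_mul]
    · rw [hopf_dihedral_mul (hp i) (hp _) (hanti i) (hq1 i) (hlift i), hlift]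

theorem regionArea_eq_sum (hp : ∀ i, p i ∈ sphereTwo) (hanti : ∀ i, p (i + 1) ≠ -p i)
    (hq : ∀ i, q i ∈ sphereThree) (hlift : ∀ i, hopf (q i) = p i) {S : ℂ → ℍ[ℝ]}
    (hS : IsEnclosedRegion p S) :
    ((regionArea S : ℝ) : AddCircle (4 * Real.pi)) =
      ((2 * ∑ i, quatArg (star (q (i + 1)) * dihedral (p i) (p (i + 1)) * q i) : ℝ) :
        AddCircle (4 * Real.pi)) := by
  have hn : (n : ℝ) ≠ 0 := Nat.cast_ne_zero.2 (NeZero.ne n)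
  have hq1 := fun i => norm_of_mem_sphereThree (hq i)
  obtain ⟨K, hK⟩ := hS.lipschitz
  obtain ⟨T, L, hT, hTS⟩ := exists_lipschitz_lift hK hS.mapsTo
  have harea := regionArea_eq_boundary_integral hT hTS
  have hmem : ∀ s : ℝ, Complex.exp (s * Complex.I) ∈ Metric.closedBall (0 : ℂ) 1 := fun s => by
    rw [mem_closedBall_zero_iff, Complex.norm_exp_ofReal_mul_I]
  set g : ℝ → ℍ[ℝ] := fun s => T (Complex.exp (s * Complex.I)) with hg
  set c : ℝ := 2 * Real.pi / n with hc
  have hgL : LipschitzWith L g := by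
    refine LipschitzWith.of_dist_le_mul fun s t => ?_
    refine (hT.dist_le_mul _ (hmem s) _ (hmem t)).trans ?_
    gcongr
    rw [dist_eq_norm]
    exact norm_exp_mul_I_sub_le s t
  -- Rescaled so that the vertices sit at the integers and edge k is [k, k + 1].
  set G : ℝ → ℍ[ℝ] := fun x => g (c * x) with hG
  have hGL : LipschitzWith (L * ‖c‖₊) G := hgL.comp (lipschitzWith_smul c)
  have hG1 : ∀ x, ‖G x‖ = 1 := fun x => (hTS _ (hmem _)).1
  have hGhopf : ∀ x, hopf (G x) = closedPath p (x / n) := fun x => by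
    rw [hG, hg, (hTS _ (hmem _)).2, ← hS.boundary]
    congr 4
    rw [hc]; ring
  have hint : ∫ t in (0 : ℝ)..2 * Real.pi, connectionForm (g t) (deriv g t) =
      ∫ x in (0 : ℝ)..n, connectionForm (G x) (deriv G x) := by
    have h1 := intervalIntegral.smul_integral_comp_mul_left (a := 0) (b := (n : ℝ))
      (fun t => connectionForm (g t) (deriv g t)) c
    rw [mul_zero, show c * n = 2 * Real.pi by rw [hc]; field_simp] at h1
    rw [← h1, ← intervalIntegral.integral_smul]
    refine intervalIntegral.integral_congr fun x _ => ?_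
    simp only [hG, deriv_comp_mul_left, map_smul]
  set A : ℕ → ℝ := fun k => ∫ x in (k : ℝ)..((k + 1 : ℕ) : ℝ), connectionForm (G x) (deriv G x)
    with hA
  have hsumA : ∑ k ∈ Finset.range n, A k = ∫ x in (0 : ℝ)..n, connectionForm (G x) (deriv G x) := by
    have := intervalIntegral.sum_integral_adjacent_intervals (n := n) (a := fun k : ℕ => (k : ℝ))
      (fun k _ => intervalIntegrable_connectionForm_deriv hGL hG1 (k : ℝ) ((k + 1 : ℕ) : ℝ))
    simpa [hA] using this
  set θ : ZMod n → ℝ :=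
    fun i => quatArg (star (q (i + 1)) * dihedral (p i) (p (i + 1)) * q i) with hθ
  have hGk : ∀ k : ℕ, hopf (G k) = p k := by
    intro k
    rw [hGhopf, closedPath_div_of_mem (k := k) ⟨le_rfl, by linarith⟩, sub_self]
    simp [shortestArc]
  -- The phase of G against the chosen lift q: along the edge G turns by A k relative to the
  -- horizontal lift from q k, whose endpoint differs from q (k + 1) by the phase θ k.
  have step : ∀ k : ℕ, star (q ((k + 1 : ℕ) : ZMod n)) * G ((k + 1 : ℕ) : ℝ) =
      ((Complex.exp ((θ k : ℝ) * Complex.I) : ℂ) : ℍ[ℝ]) * (star (q k) * G k *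
        ((Complex.exp ((A k : ℝ) * Complex.I) : ℂ) : ℍ[ℝ])) := by
    intro k
    obtain ⟨H, H1, H2, H3, H4, H5, H6⟩ := exists_horizontal_lift_shortestArc (hp k) (hp (k + 1))
      (hanti k) (hq1 k) (hlift k) (k : ℝ)
    have h1 := star_mul_eq_mul_exp_of_horizontal (a := (k : ℝ)) (b := ((k + 1 : ℕ) : ℝ))
      (by push_cast; linarith) hGL hG1 H1 H2 H3 (fun t ht => by
        push_cast at ht
        rw [H4, hGhopf, closedPath_div_of_mem ⟨ht.1.le, ht.2⟩])
    rw [H5] at h1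
    have hθk : ((Complex.exp ((θ k : ℝ) * Complex.I) : ℂ) : ℍ[ℝ]) =
        star (q (k + 1)) * dihedral (p k) (p (k + 1)) * q k :=
      (star_mul_dihedral_mul_eq hp hanti hq hlift k).symm
    rw [← h1, hθk]
    have h2 : H ((k + 1 : ℕ) : ℝ) = dihedral (p k) (p (k + 1)) * q k := by
      rw [← H6]; push_cast; rfl
    have hD : ‖dihedral (p k) (p (k + 1)) * q k‖ = 1 := by rw [← h2, H2]
    rw [h2, mul_assoc (star (q (k + 1))), mul_assoc (star (q (k + 1))),
      ← mul_assoc (dihedral (p k) (p (k + 1)) * q k), mul_star_of_norm_eq_one hD, one_mul,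
      Nat.cast_add, Nat.cast_one]
  obtain ⟨z, hz⟩ : ∃ z : ℂ, star (q (0 : ℕ)) * G (0 : ℕ) = (z : ℍ[ℝ]) :=
    ⟨_, eq_coeComplex_of_commute (star_mul_commute (hq1 _) (hG1 _) (by rw [hlift, hGk]))⟩
  have main : ∀ k : ℕ, star (q k) * G k =
      ((z * Complex.exp ((∑ j ∈ Finset.range k, (θ j + A j) : ℝ) * Complex.I) : ℂ) : ℍ[ℝ]) := by
    intro k
    induction k with
    | zero => simp only [hz, Finset.range_zero, Finset.sum_empty, Complex.ofReal_zero, zero_mul,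
        Complex.exp_zero, mul_one]
    | succ k ih =>
      rw [step, ih, ← Quaternion.coeComplex_mul, ← Quaternion.coeComplex_mul,
        Finset.sum_range_succ]
      congr 1
      push_cast
      rw [add_mul, add_mul (θ k : ℂ), Complex.exp_add, Complex.exp_add]
      ring
  have hGn : G n = G (0 : ℕ) := by
    simp only [hG, hg]
    rw [show c * n = 2 * Real.pi by rw [hc]; field_simp]
    simp
  -- After n edges both q and G return to their initial values, so the nonzero initial phase z
  -- cancels.
  have hloop := main n
  rw [ZMod.natCast_self, hGn, ← Nat.cast_zero (R := ZMod n), hz] at hloop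
  have hz0 : z ≠ 0 := by
    rw [← norm_ne_zero_iff, ← norm_coeComplex, ← hz, norm_mul, norm_star, hq1, hG1]
    norm_num
  have hexp : Complex.exp ((∑ j ∈ Finset.range n, (θ j + A j) : ℝ) * Complex.I) = 1 := by
    have h1 : z = z * Complex.exp ((∑ j ∈ Finset.range n, (θ j + A j) : ℝ) * Complex.I) := by
      apply Complex.ext
      · simpa only [Quaternion.re_coeComplex] using congrArg QuaternionAlgebra.re hloop
      · simpa only [Quaternion.imI_coeComplex] using congrArg QuaternionAlgebra.imI hloop
    exact (mul_right_eq_self₀.1 h1.symm).resolve_right hz0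
  obtain ⟨m, hm⟩ := Complex.exp_eq_one_iff.1 hexp
  have hm' : ∑ j ∈ Finset.range n, (θ j + A j) = m * (2 * Real.pi) := by
    have h1 : ((∑ j ∈ Finset.range n, (θ j + A j) : ℝ) : ℂ) = ((m * (2 * Real.pi) : ℝ) : ℂ) := by
      apply mul_right_cancel₀ Complex.I_ne_zero
      rw [hm]; push_cast; ring
    exact_mod_cast h1
  rw [Finset.sum_add_distrib, sum_range_natCast_eq_sum_zmod, hsumA, ← hint] at hm'
  rw [← sub_eq_zero, ← AddCircle.coe_sub, AddCircle.coe_eq_zero_iff]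
  -- Area = -2ΣA and Σθ + ΣA = 2πm, so the difference is -m · 4π.
  refine ⟨-m, ?_⟩
  rw [harea, zsmul_eq_mul]
  push_cast
  linarith

/-- Almost everywhere the density is -4 times the connection form of the two partial derivatives of
a lift, which is measurable and bounded because the lift is Lipschitz. -/
theorem integrableOn_pullbackArea {S : ℂ → ℍ[ℝ]} {K : NNReal}
    (hK : LipschitzOnWith K S (Metric.closedBall 0 1))
    (hmaps : MapsTo S (Metric.closedBall 0 1) sphereTwo) :
    IntegrableOn (pullbackArea S) (Metric.ball (0 : ℂ) 1) := by
  have hball : MeasurableSet (Metric.ball (0 : ℂ) 1) := Metric.isOpen_ball.measurableSet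
  obtain ⟨T, L, hT, hTS⟩ := exists_lipschitz_lift hK hmaps
  have hdiff := (hT.mono Metric.ball_subset_closedBall).ae_differentiableWithinAt (μ := volume)
    hball
  have hfd : ∀ v : ℂ, AEStronglyMeasurable (fun z => fderiv ℝ T z v) volume := by
    intro v
    borelize ℍ[ℝ]
    exact (measurable_fderiv_apply_const ℝ T v).aestronglyMeasurable
  have cB : Continuous fun p : ℍ[ℝ] × ℍ[ℝ] => connectionForm p.1 p.2 := by fun_prop
  have hmeas := Continuous.comp_aestronglyMeasurable
    (f := fun z => (fderiv ℝ T z 1, fderiv ℝ T z Complex.I)) cB ((hfd 1).prodMk (hfd Complex.I))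
  have hint : IntegrableOn (fun z => connectionForm (fderiv ℝ T z 1) (fderiv ℝ T z Complex.I))
      (Metric.ball (0 : ℂ) 1) := by
    refine Measure.integrableOn_of_bounded (M := L * L) Metric.isBounded_ball.measure_lt_top.ne
      hmeas ?_
    filter_upwards [ae_restrict_mem hball] with z hz
    have h1 : ‖fderiv ℝ T z‖ ≤ L := norm_fderiv_le_of_lipschitzOn ℝ
      (Metric.isOpen_ball.mem_nhds hz) (hT.mono Metric.ball_subset_closedBall)
    have h2 : ∀ v : ℂ, ‖v‖ = 1 → ‖fderiv ℝ T z v‖ ≤ L := fun v hv =>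
      ((fderiv ℝ T z).le_opNorm v).trans (by rw [hv, mul_one]; exact h1)
    refine (abs_connectionForm_le _ _).trans ?_
    gcongr
    · exact h2 _ norm_one
    · exact h2 _ Complex.norm_I
  refine (hint.const_mul (-4)).congr ?_
  filter_upwards [hdiff, ae_restrict_mem hball] with z hz hzb
  exact (pullbackArea_eq_of_lift (hz.differentiableAt (Metric.isOpen_ball.mem_nhds hzb))
    ((Metric.isOpen_ball.eventually_mem hzb).mono fun w hw =>
      hTS w (Metric.ball_subset_closedBall hw))).symm

end AreaFormula

/-! ### Existence of an enclosed region -/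

section Existence

theorem shortestArc_mem_sphereTwo {p p' : ℍ[ℝ]} (hp : p ∈ sphereTwo) (hp' : p' ∈ sphereTwo)
    (h : p' ≠ -p) (t : ℝ) : shortestArc p p' t ∈ sphereTwo := by
  obtain ⟨q, hq, hpq⟩ := exists_hopf_eq hp
  obtain ⟨H, -, H1, -, H2, -⟩ := exists_horizontal_lift_shortestArc hp hp' h hq hpq 0
  rw [← sub_zero t, ← H2]
  exact hopf_mem_sphereTwo (H1 t)

theorem shortestArc_zero (p p' : ℍ[ℝ]) : shortestArc p p' 0 = p := by simp [shortestArc]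

theorem shortestArc_one {p p' : ℍ[ℝ]} (hp : p ∈ sphereTwo) (hp' : p' ∈ sphereTwo)
    (h : p' ≠ -p) : shortestArc p p' 1 = p' := by
  rcases eq_or_ne p p' with rfl | hne
  · exact shortestArc_self hp 1
  · obtain ⟨ω, u, -, -, -, -, h1, h2⟩ := exists_shortestArc_eq hp hp' h hne
    rw [h2, one_mul, ← h1]

theorem norm_shortestArc_sub_le {p p' : ℍ[ℝ]} (hp : p ∈ sphereTwo) (hp' : p' ∈ sphereTwo)
    (h : p' ≠ -p) (s t : ℝ) :
    ‖shortestArc p p' s - shortestArc p p' t‖ ≤ 2 * Real.pi * |s - t| := by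
  rcases eq_or_ne p p' with rfl | hne
  · rw [shortestArc_self hp, shortestArc_self hp, sub_self, norm_zero]
    positivity
  · obtain ⟨ω, u, h0, hπ, hu, -, -, h2⟩ := exists_shortestArc_eq hp hp' h hne
    have e : Real.cos (s * ω) • p + Real.sin (s * ω) • u -
        (Real.cos (t * ω) • p + Real.sin (t * ω) • u) =
        (Real.cos (s * ω) - Real.cos (t * ω)) • p + (Real.sin (s * ω) - Real.sin (t * ω)) • u := by
      module
    rw [h2, h2, e]
    refine (norm_add_le _ _).trans ?_
    rw [norm_smul, norm_smul, hp.2, hu.2, mul_one, mul_one, Real.norm_eq_abs, Real.norm_eq_abs]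
    have h3 := Real.abs_cos_sub_cos_le (s * ω) (t * ω)
    have h4 := Real.abs_sin_sub_sin_le (s * ω) (t * ω)
    rw [← sub_mul, abs_mul, abs_of_nonneg h0] at h3 h4
    nlinarith [abs_nonneg (s - t)]

theorem norm_sub_le_of_forall_Icc_int {E : Type*} [NormedAddCommGroup E] {f : ℝ → E} {C : ℝ}
    (h : ∀ k : ℤ, ∀ x ∈ Icc (k : ℝ) (k + 1), ∀ y ∈ Icc (k : ℝ) (k + 1),
      ‖f x - f y‖ ≤ C * |x - y|) (x y : ℝ) : ‖f x - f y‖ ≤ C * |x - y| := by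
  wlog hxy : x ≤ y generalizing x y
  · rw [norm_sub_rev, abs_sub_comm]
    exact this y x (le_of_not_ge hxy)
  -- Induction on the integers between x and y; splitting there loses nothing, since lengths add.
  have main : ∀ m : ℕ, ∀ y, x ≤ y → y ≤ ⌊x⌋ + 1 + m → ‖f x - f y‖ ≤ C * |x - y| := by
    intro m
    induction m with
    | zero =>
      intro y hxy hy
      have h1 := Int.floor_le x
      have h2 := Int.lt_floor_add_one x
      simp only [Nat.cast_zero, add_zero] at hy
      exact h ⌊x⌋ x ⟨h1, h2.le⟩ y ⟨h1.trans hxy, hy⟩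
    | succ m ih =>
      intro y hxy hy
      rcases le_total y (⌊x⌋ + 1 + m) with h1 | h1
      · exact ih y hxy h1
      · have h2 := Int.lt_floor_add_one x
        have hm : (0 : ℝ) ≤ m := Nat.cast_nonneg m
        have h3 := ih (⌊x⌋ + 1 + m) (by linarith) le_rfl
        push_cast at hy
        have h4 := h (⌊x⌋ + 1 + m) (⌊x⌋ + 1 + m) (by push_cast; exact ⟨le_rfl, by linarith⟩) y
          (by push_cast; exact ⟨h1, by linarith⟩)
        rw [abs_of_nonpos (by linarith)] at h3 h4 ⊢
        linarith [norm_sub_le_norm_sub_add_norm_sub (f x) (f (⌊x⌋ + 1 + m)) (f y)]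
  obtain ⟨m, hm⟩ := exists_nat_ge (y - x)
  exact main m y hxy (by linarith [Int.lt_floor_add_one x])

section ClosedPath

variable {n : ℕ} {p : ZMod n → ℍ[ℝ]}

theorem closedPath_mem_sphereTwo (hp : ∀ i, p i ∈ sphereTwo) (hanti : ∀ i, p (i + 1) ≠ -p i)
    (t : ℝ) : closedPath p t ∈ sphereTwo :=
  shortestArc_mem_sphereTwo (hp _) (hp _) (hanti _) _

theorem closedPath_periodic : Function.Periodic (closedPath p) 1 := by
  intro t
  have h : (n : ℝ) * (t + 1) = n * t + (n : ℤ) := by push_cast; ring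
  rw [closedPath, closedPath, h, Int.floor_add_intCast, Int.fract_add_intCast]
  simp

theorem norm_closedPath_sub_le [NeZero n] (hp : ∀ i, p i ∈ sphereTwo)
    (hanti : ∀ i, p (i + 1) ≠ -p i) (s t : ℝ) :
    ‖closedPath p s - closedPath p t‖ ≤ 2 * Real.pi * n * |s - t| := by
  have hn : (n : ℝ) ≠ 0 := Nat.cast_ne_zero.2 (NeZero.ne n)
  have arc : ∀ k : ℤ, ∀ x ∈ Icc (k : ℝ) (k + 1),
      closedPath p (x / n) = shortestArc (p k) (p (k + 1)) (x - k) := by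
    intro k x hx
    rcases eq_or_lt_of_le hx.2 with h | h
    -- At the right endpoint the floor has already jumped to the next edge; the two arcs agree there
    -- because both give p (k + 1).
    · rw [h, closedPath_div, add_sub_cancel_left, shortestArc_one (hp _) (hp _) (hanti _),
        show (k : ℝ) + 1 = ((k + 1 : ℤ) : ℝ) by push_cast; rfl, Int.floor_intCast,
        Int.fract_intCast, shortestArc_zero]
      push_cast; rfl
    · have hk : ⌊x⌋ = k := Int.floor_eq_iff.2 ⟨hx.1, h⟩
      rw [closedPath_div, Int.fract, hk]
  have h := norm_sub_le_of_forall_Icc_int (f := fun x => closedPath p (x / n))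
    (C := 2 * Real.pi) (fun k x hx y hy => by
      rw [arc k x hx, arc k y hy]
      have := norm_shortestArc_sub_le (hp k) (hp (k + 1)) (hanti k) (x - k) (y - k)
      rwa [sub_sub_sub_cancel_right] at this) (n * s) (n * t)
  simp only [mul_div_cancel_left₀ _ hn] at h
  rwa [← mul_sub, abs_mul, Nat.abs_cast, ← mul_assoc] at h

/-- The closed path of a polygon as a function of the point on the unit circle (extended to the
whole plane by means of the argument). -/
def circlePath (p : ZMod n → ℍ[ℝ]) (z : ℂ) : ℍ[ℝ] := closedPath p (Complex.arg z / (2 * Real.pi))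

theorem circlePath_eq_closedPath {z : ℂ} (hz : ‖z‖ = 1) {t : ℝ}
    (h : z = Complex.exp ((2 * Real.pi * t : ℝ) * Complex.I)) : circlePath p z = closedPath p t := by
  have h1 : Complex.exp (Complex.arg z * Complex.I) =
      Complex.exp ((2 * Real.pi * t : ℝ) * Complex.I) := by
    have := Complex.norm_mul_exp_arg_mul_I z
    rw [hz, Complex.ofReal_one, one_mul] at this
    rw [this, h]
  obtain ⟨m, hm⟩ := Complex.exp_eq_exp_iff_exists_int.1 h1
  have h2 : ((Complex.arg z : ℝ) : ℂ) = ((2 * Real.pi * (t + m) : ℝ) : ℂ) := by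
    apply mul_right_cancel₀ Complex.I_ne_zero
    rw [hm]; push_cast; ring
  have h3 : Complex.arg z = 2 * Real.pi * (t + m) := by exact_mod_cast h2
  rw [circlePath, h3, mul_div_cancel_left₀ _ Real.two_pi_pos.ne']
  simpa using closedPath_periodic.int_mul m t

theorem norm_circlePath_sub_le [NeZero n] (hp : ∀ i, p i ∈ sphereTwo)
    (hanti : ∀ i, p (i + 1) ≠ -p i) {z w : ℂ} (hz : ‖z‖ = 1) (hw : ‖w‖ = 1) :
    ‖circlePath p z - circlePath p w‖ ≤ n * Real.pi * ‖z - w‖ := by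
  have hz0 : z ≠ 0 := norm_ne_zero_iff.1 (by rw [hz]; norm_num)
  have hw0 : w ≠ 0 := norm_ne_zero_iff.1 (by rw [hw]; norm_num)
  have hangle := (Complex.norm_sub_mem_Icc_angle hz hw).1
  rw [Complex.angle_eq_abs_arg hz0 hw0] at hangle
  have polar : ∀ x : ℂ, ‖x‖ = 1 → Complex.exp (Complex.arg x * Complex.I) = x := fun x hx => by
    have := Complex.norm_mul_exp_arg_mul_I x
    rwa [hx, Complex.ofReal_one, one_mul] at this
  -- Writing z as w rotated by arg (z / w) avoids the branch cut of `arg`; chord and angle are then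
  -- comparable.
  have e : z = Complex.exp ((2 * Real.pi *
      ((Complex.arg w + Complex.arg (z / w)) / (2 * Real.pi)) : ℝ) * Complex.I) := by
    rw [mul_div_cancel₀ _ Real.two_pi_pos.ne', Complex.ofReal_add, add_mul, Complex.exp_add,
      polar w hw, polar (z / w) (by rw [norm_div, hz, hw, div_one]), mul_div_cancel₀ _ hw0]
  rw [circlePath_eq_closedPath hz e, circlePath]
  refine (norm_closedPath_sub_le hp hanti _ _).trans ?_
  rw [← sub_div, add_sub_cancel_left, abs_div, abs_of_pos Real.two_pi_pos]
  have h1 : |Complex.arg (z / w)| ≤ Real.pi * ‖z - w‖ := by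
    have hπ := Real.pi_pos
    have h2 : 2 * |Complex.arg (z / w)| ≤ Real.pi * ‖z - w‖ := by
      calc 2 * |Complex.arg (z / w)| = Real.pi * (2 / Real.pi * |Complex.arg (z / w)|) := by
            field_simp
        _ ≤ _ := by gcongr
    linarith [abs_nonneg (Complex.arg (z / w))]
  calc 2 * Real.pi * n * (|Complex.arg (z / w)| / (2 * Real.pi)) = n * |Complex.arg (z / w)| := by
        field_simp
    _ ≤ n * (Real.pi * ‖z - w‖) := by gcongr
    _ = _ := by ring

/-- The edges of a polygon do not fill the sphere. -/
theorem exists_closedPath_ne_neg [NeZero n] (p : ZMod n → ℍ[ℝ]) :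
    ∃ v ∈ sphereTwo, ∀ t, closedPath p t ≠ -v := by
  -- Each edge lies in a subspace of dimension at most 3, and finitely many of these cannot fill ℍ.
  -- Including 1 in the span lets the real part of an outside vector be removed.
  have hne : (⋃ i : ZMod n, (Submodule.span ℝ {1, p i, p (i + 1)} : Set ℍ[ℝ])) ≠ univ := by
    intro h
    obtain ⟨i, hi⟩ := Subspace.exists_eq_top_of_iUnion_eq_univ h
    classical
    have h1 := finrank_span_finset_le_card (R := ℝ) ({1, p i, p (i + 1)} : Finset ℍ[ℝ])
    rw [Set.finrank, Finset.coe_insert, Finset.coe_insert, Finset.coe_singleton, hi, finrank_top, Quaternion.finrank_eq_four] at h1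
    have h2 := Finset.card_le_three (a := (1 : ℍ[ℝ])) (b := p i) (c := p (i + 1))
    omega
  obtain ⟨x, hx⟩ := (ne_univ_iff_exists_notMem _).1 hne
  simp only [mem_iUnion, SetLike.mem_coe, not_exists] at hx
  set y := x - x.re • (1 : ℍ[ℝ]) with hy
  have hy1 : ∀ i, y ∉ Submodule.span ℝ {1, p i, p (i + 1)} := by
    intro i hyi
    apply hx i
    have h1 : (1 : ℍ[ℝ]) ∈ Submodule.span ℝ {1, p i, p (i + 1)} :=
      Submodule.subset_span (by simp)
    have := Submodule.add_mem _ hyi (Submodule.smul_mem _ x.re h1)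
    rwa [hy, sub_add_cancel] at this
  have hy0 : y ≠ 0 := fun h => hy1 0 (h ▸ Submodule.zero_mem _)
  refine ⟨‖y‖⁻¹ • y, ⟨by simp [hy], ?_⟩, fun t ht => ?_⟩
  · rw [norm_smul, norm_inv, norm_norm, inv_mul_cancel₀ (norm_ne_zero_iff.2 hy0)]
  · set i : ZMod n := ((⌊n * t⌋ : ℤ) : ZMod n) with hi
    apply hy1 i
    have ha : p i ∈ Submodule.span ℝ {1, p i, p (i + 1)} := Submodule.subset_span (by simp)
    have hb : p (i + 1) ∈ Submodule.span ℝ {1, p i, p (i + 1)} := Submodule.subset_span (by simp)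
    have hc : closedPath p t ∈ Submodule.span ℝ {1, p i, p (i + 1)} :=
      Submodule.add_mem _ (Submodule.smul_mem _ _ ha) (Submodule.smul_mem _ _
        (Submodule.smul_mem _ _ (Submodule.sub_mem _ hb (Submodule.smul_mem _ _ ha))))
    have := Submodule.smul_mem _ (-‖y‖) hc
    rwa [ht, neg_smul_neg, smul_smul, mul_inv_cancel₀ (norm_ne_zero_iff.2 hy0), one_smul] at this

/-- The linear cone over a Lipschitz map on the circle is Lipschitz. -/
theorem norm_smul_sub_smul_le_of_circle {f : ℂ → ℍ[ℝ]} {C : ℝ} (hC : 0 ≤ C)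
    (hf1 : ∀ z, ‖f z‖ ≤ 1)
    (hf : ∀ z w, ‖z‖ = 1 → ‖w‖ = 1 → ‖f z - f w‖ ≤ C * ‖z - w‖) (z w : ℂ) :
    ‖‖z‖ • f (‖z‖⁻¹ • z) - ‖w‖ • f (‖w‖⁻¹ • w)‖ ≤ (1 + 2 * C) * ‖z - w‖ := by
  have h0 : ∀ x : ℂ, ‖‖x‖ • f (‖x‖⁻¹ • x)‖ ≤ ‖x‖ := fun x => by
    rw [norm_smul, norm_norm]; exact mul_le_of_le_one_right (norm_nonneg x) (hf1 _)
  have hunit : ∀ x : ℂ, x ≠ 0 → ‖‖x‖⁻¹ • x‖ = 1 := fun x hx => by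
    rw [norm_smul, norm_inv, norm_norm, inv_mul_cancel₀ (norm_ne_zero_iff.2 hx)]
  rcases eq_or_ne z 0 with rfl | hz
  · simpa using (h0 w).trans (le_mul_of_one_le_left (norm_nonneg w) (by linarith))
  rcases eq_or_ne w 0 with rfl | hw
  · simpa using (h0 z).trans (le_mul_of_one_le_left (norm_nonneg z) (by linarith))
  have e : ‖z‖ • f (‖z‖⁻¹ • z) - ‖w‖ • f (‖w‖⁻¹ • w) =
      ‖z‖ • (f (‖z‖⁻¹ • z) - f (‖w‖⁻¹ • w)) + (‖z‖ - ‖w‖) • f (‖w‖⁻¹ • w) := by module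
  rw [e]
  refine (norm_add_le _ _).trans ?_
  rw [norm_smul, norm_smul, norm_norm, Real.norm_eq_abs]
  have h1 := hf _ _ (hunit z hz) (hunit w hw)
  have h2 := norm_mul_norm_normalize_sub_le z w
  have h3 := abs_norm_sub_norm_le z w
  have h4 := hf1 (‖w‖⁻¹ • w)
  calc _ ≤ ‖z‖ * (C * ‖‖z‖⁻¹ • z - ‖w‖⁻¹ • w‖) + ‖z - w‖ * 1 := by gcongr
    _ = C * (‖z‖ * ‖‖z‖⁻¹ • z - ‖w‖⁻¹ • w‖) + ‖z - w‖ := by ring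
    _ ≤ C * (2 * ‖z - w‖) + ‖z - w‖ := by gcongr
    _ = _ := by ring

theorem exists_isEnclosedRegion [NeZero n] (hp : ∀ i, p i ∈ sphereTwo)
    (hanti : ∀ i, p (i + 1) ≠ -p i) : ∃ S, IsEnclosedRegion p S := by
  obtain ⟨v, hv, hvp⟩ := exists_closedPath_ne_neg p
  have hc2 : ∀ z, circlePath p z ∈ sphereTwo := fun z => closedPath_mem_sphereTwo hp hanti _
  -- The straight cone from v over the boundary path, later pushed radially to the sphere.
  set h : ℂ → ℍ[ℝ] := fun z => (1 - ‖z‖) • v + ‖z‖ • circlePath p (‖z‖⁻¹ • z) with hh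
  obtain ⟨C, hC0, hC⟩ : ∃ C : ℝ, 0 ≤ C ∧ ∀ z w, ‖h z - h w‖ ≤ C * ‖z - w‖ := by
    have hC0 : 0 ≤ n * Real.pi := by positivity
    refine ⟨1 + (1 + 2 * (n * Real.pi)), by positivity, fun z w => ?_⟩
    have h1 := norm_smul_sub_smul_le_of_circle hC0 (fun z => (hc2 z).2.le)
      (fun z w hz hw => norm_circlePath_sub_le hp hanti hz hw) z w
    have e : h z - h w = (‖w‖ - ‖z‖) • v + (‖z‖ • circlePath p (‖z‖⁻¹ • z) -
        ‖w‖ • circlePath p (‖w‖⁻¹ • w)) := by simp only [hh]; module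
    rw [e]
    refine (norm_add_le _ _).trans ?_
    rw [norm_smul, hv.2, mul_one, Real.norm_eq_abs, abs_sub_comm]
    linarith [abs_norm_sub_norm_le z w]
  have hcont : Continuous h := by
    refine (LipschitzWith.of_dist_le_mul (K := C.toNNReal) fun z w => ?_).continuous
    rw [dist_eq_norm, dist_eq_norm, Real.coe_toNNReal _ hC0]
    exact hC z w
  have hne : ∀ z ∈ Metric.closedBall (0 : ℂ) 1, h z ≠ 0 := by
    intro z hz hz0
    rw [mem_closedBall_zero_iff] at hz
    have h1 : ‖z‖ • circlePath p (‖z‖⁻¹ • z) = -((1 - ‖z‖) • v) :=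
      eq_neg_of_add_eq_zero_right hz0
    have h2 := congrArg norm h1
    rw [norm_neg, norm_smul, norm_smul, hv.2, (hc2 _).2, norm_norm,
      Real.norm_of_nonneg (by linarith)] at h2
    -- Two opposite multiples of unit vectors have equal length only at the midpoint, which would
    -- put -v on the path.
    have h3 : ‖z‖ = 1 / 2 := by linarith
    rw [h3, show (1 : ℝ) - 1 / 2 = 1 / 2 by norm_num, ← smul_neg] at h1
    exact hvp _ (smul_right_injective _ (by norm_num : (1 / 2 : ℝ) ≠ 0) h1)
  -- Compactness bounds ‖h‖ below on the disk, which keeps the radial projection Lipschitz.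
  obtain ⟨z₀, hz₀, hmin⟩ := (isCompact_closedBall (0 : ℂ) 1).exists_isMinOn
    ⟨0, Metric.mem_closedBall_self zero_le_one⟩ hcont.norm.continuousOn
  have hδ : 0 < ‖h z₀‖ := norm_pos_iff.2 (hne z₀ hz₀)
  refine ⟨fun z => ‖h z‖⁻¹ • h z, ⟨(2 * C / ‖h z₀‖).toNNReal,
    LipschitzOnWith.of_dist_le_mul fun z hz w hw => ?_⟩, fun z hz => ⟨?_, ?_⟩, fun t => ?_⟩
  · rw [dist_eq_norm, dist_eq_norm, Real.coe_toNNReal _ (by positivity), div_mul_eq_mul_div,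
      le_div_iff₀ hδ]
    have h1 := norm_mul_norm_normalize_sub_le (h z) (h w)
    have h2 : ‖h z₀‖ ≤ ‖h z‖ := hmin hz
    nlinarith [hC z w, norm_nonneg (‖h z‖⁻¹ • h z - ‖h w‖⁻¹ • h w)]
  · simp [hh, hv.1, (hc2 _).1]
  · rw [norm_smul, norm_inv, norm_norm, inv_mul_cancel₀ (norm_ne_zero_iff.2 (hne z hz))]
  · have hz1 : ‖Complex.exp ((2 * Real.pi * t : ℝ) * Complex.I)‖ = 1 :=
      Complex.norm_exp_ofReal_mul_I _
    have h1 : h (Complex.exp ((2 * Real.pi * t : ℝ) * Complex.I)) = closedPath p t := by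
      simp only [hh]
      rw [hz1, sub_self, zero_smul, zero_add, inv_one, one_smul, one_smul]
      exact circlePath_eq_closedPath hz1 rfl
    simp only [h1, (closedPath_mem_sphereTwo hp hanti t).2, inv_one, one_smul]

end ClosedPath

end Existence

end SphericalPolygon

end

theorem mainTheorem1 (n : ℕ) [NeZero n] (p q : ZMod n → Quaternion ℝ)
    (hp : ∀ i, p i ∈ SphericalPolygon.sphereTwo)
    (hanti : ∀ i, p (i + 1) ≠ -p i)
    (hq : ∀ i, q i ∈ SphericalPolygon.sphereThree)
    (hlift : ∀ i, SphericalPolygon.hopf (q i) = p i) :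
    -- the area of the polygon is well defined: there is an enclosed region, its area form is
    -- integrable, and its total signed area mod 4π does not depend on the region
    (∃ S, SphericalPolygon.IsEnclosedRegion p S) ∧
    (∀ S, SphericalPolygon.IsEnclosedRegion p S →
      MeasureTheory.IntegrableOn (SphericalPolygon.pullbackArea S) (Metric.ball (0 : ℂ) 1) ∧
      ((SphericalPolygon.regionArea S : ℝ) : AddCircle (4 * Real.pi)) =
        SphericalPolygon.signedArea p) ∧
    -- the arguments in the formula are arguments of quaternions of the form e^{iθ}
    (∀ i, star (q (i + 1)) * SphericalPolygon.dihedral (p i) (p (i + 1)) * q i =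
      ((Complex.exp ((SphericalPolygon.quatArg
        (star (q (i + 1)) * SphericalPolygon.dihedral (p i) (p (i + 1)) * q i) : ℝ) * Complex.I) :
          ℂ) : Quaternion ℝ)) ∧
    -- the area formula
    SphericalPolygon.signedArea p =
      ((2 * ∑ i, SphericalPolygon.quatArg
        (star (q (i + 1)) * SphericalPolygon.dihedral (p i) (p (i + 1)) * q i) : ℝ) :
          AddCircle (4 * Real.pi)) := by
  have hex := SphericalPolygon.exists_isEnclosedRegion hp hanti
  have harea : SphericalPolygon.signedArea p =
      ((2 * ∑ i, SphericalPolygon.quatArg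
        (star (q (i + 1)) * SphericalPolygon.dihedral (p i) (p (i + 1)) * q i) : ℝ) :
          AddCircle (4 * Real.pi)) := by
    -- `signedArea` refers to one chosen region, but the formula holds for every region, so the
    -- choice is immaterial.
    rw [SphericalPolygon.signedArea, dif_pos hex]
    exact SphericalPolygon.regionArea_eq_sum hp hanti hq hlift hex.choose_spec
  refine ⟨hex, fun S hS => ⟨?_, ?_⟩,
    SphericalPolygon.star_mul_dihedral_mul_eq hp hanti hq hlift, harea⟩
  · obtain ⟨K, hK⟩ := hS.lipschitz
    exact SphericalPolygon.integrableOn_pullbackArea hK hS.mapsTo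
  · rw [harea]
    exact SphericalPolygon.regionArea_eq_sum hp hanti hq hlift hS
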